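/- **Setting.** Let $H$ and $E$ be separable real Hilbert spaces and let $V$ be a Banach space that is compactly and densely embedded in $H$. Let $S: H\times E\to V$ be a map, let $(\eta_k)_{k\ge1}$ be i.i.d. random variables in $E$ with law $\ell$, and suppose that the support $\mathcal K:=\operatorname{supp}\ell$ is compact in $E$. For $u\in H$ let $u_0(u)=u$, $u_k(u)=S(u_{k-1}(u),\eta_k)$ for $k\ge1$, and let $P_k(u,\cdot)$ be the law of $u_k(u)$ on $H$, $k\ge0$. Let $B_H(R)$ be the closed ball of radius $R$ in $H$ centred at the origin. For Borel probability measures $\mu,\nu$ on $H$ put $$\|\mu-\nu\|_L^*=\sup\Big\{\Big|\int_H f\,d\mu-\int_H f\,d\nu\Big| : f:H\to\mathbb R,\ \sup_H|f|\le1,\ \operatorname{Lip}(f)\le1\Big\}.$$ **Assumptions.** (A1) $S:H\times E\to V$ is twice continuously differentiable, and its derivatives up to second order are bounded on bounded sets. (H1) There are an orthonormal basis $(e_j)_{j\ge1}$ of $E$, real numbers $b_j\neq0$ with $\sum_j b_j^2<\infty$, and independent real random variables $\xi_{jk}$, $j,k\ge1$, such that almost surely $\eta_k=\sum_{j\ge1}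 b_j\xi_{jk}e_j$ and $|\xi_{jk}|\le1$, and the law of $\xi_{jk}$ is $\rho_j(r)\,dr$ with a Lipschitz density $\rho_j:\mathbb R\to[0,\infty)$ satisfying $\rho_j(0)\ne0$. (H2) There are constants $0<\gamma<1$ and $\beta>0$ such that $\|S(u,\eta)\|_H\le\gamma\|u\|_H+\beta$ and $\|S(u,0)\|_H\le\gamma\|u\|_H$ for all $u\in H$, $\eta\in\mathcal K$. (H3) For all $u\in H$ and $\eta\in\mathcal K$ the image of the operator $D_\eta S(u,\eta):E\to V$ is dense in $H$. **Theorem.** Assume (A1), (H1), (H2) and (H3). Then for every $R_*>0$ there are constants $\kappa\in(0,1)$ and $C>0$ such that for all $u,u'\in B_H(R_*)$ and all integers $k\ge0$, $$\|P_k(u,\cdot)-P_k(u',\cdot)\|_L^*\le C\,\|u-u'\|_H\,\kappa^k .$$ -/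

import Mathlib

open MeasureTheory ProbabilityTheory Set

noncomputable section

namespace RDS

/-- The values `|⟨μ - ν, f⟩|` over all Lipschitz functions `f` on `X` with
`sup |f| ∨ Lip f ≤ 1`. -/
def lipDualSet {X : Type*} [PseudoEMetricSpace X] [MeasurableSpace X] (μ ν : Measure X) : Set ℝ :=
  {r | ∃ f : X → ℝ, (∀ x, |f x| ≤ 1) ∧ LipschitzWith 1 f ∧ r = |∫ x, f x ∂μ - ∫ x, f x ∂ν|}

/-- The Lipschitz-dual distance `‖μ - ν‖_L^*`. -/
def lipDual {X : Type*} [PseudoEMetricSpace X] [MeasurableSpace X] (μ ν : Measure X) : ℝ :=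
  sSup (lipDualSet μ ν)

/-- For probability measures the set under the supremum is bounded, so that `lipDual` is a genuine
supremum. -/
lemma bddAbove_lipDualSet {X : Type*} [PseudoEMetricSpace X] [MeasurableSpace X]
    (μ ν : Measure X) [IsProbabilityMeasure μ] [IsProbabilityMeasure ν] :
    BddAbove (lipDualSet μ ν) := by
  refine ⟨2, ?_⟩
  rintro r ⟨f, hf, -, rfl⟩
  have hμ := norm_integral_le_of_norm_le_const (μ := μ) (f := f) (C := 1)
    (Filter.Eventually.of_forall hf)
  have hν := norm_integral_le_of_norm_le_const (μ := ν) (f := f) (C := 1)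
    (Filter.Eventually.of_forall hf)
  simp only [Real.norm_eq_abs, probReal_univ, mul_one] at hμ hν
  calc |∫ x, f x ∂μ - ∫ x, f x ∂ν| ≤ |∫ x, f x ∂μ| + |∫ x, f x ∂ν| := abs_sub _ _
    _ ≤ 2 := by linarith

lemma lipDualSet_nonempty {X : Type*} [PseudoEMetricSpace X] [MeasurableSpace X]
    (μ ν : Measure X) : (lipDualSet μ ν).Nonempty :=
  ⟨_, fun _ => 0, by simp, LipschitzWith.const' 0, rfl⟩

section System

variable {H E V Ω : Type*}
  [NormedAddCommGroup H] [InnerProductSpace ℝ H]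
  [NormedAddCommGroup E] [InnerProductSpace ℝ E]
  [NormedAddCommGroup V] [NormedSpace ℝ V]

/-- The trajectory `u_0 = v`, `u_k = S (u_{k-1}, η_k)`, seen in `H` through the embedding
`ι : V → H`; the noise sequence is indexed from `0`, so that `η k` drives the step from time `k` to
time `k + 1`. -/
def traj (ι : V →L[ℝ] H) (S : H × E → V) (η : ℕ → Ω → E) (v : H) : ℕ → Ω → H
  | 0, _ => v
  | k + 1, ω => ι (S (traj ι S η v k ω, η k ω))

/-- The transition probability after `k` steps: `P_k(u, Γ) = Prob (u_k(u) ∈ Γ)`. -/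
def transProb [MeasurableSpace H] [MeasurableSpace Ω] (P : Measure Ω)
    (ι : V →L[ℝ] H) (S : H × E → V) (η : ℕ → Ω → E) (k : ℕ) (u : H) : Measure H :=
  P.map (traj ι S η u k)

/-- Regularity: `S` is twice continuously differentiable and its derivatives up to second order are
bounded on bounded sets. -/
def Regularity (S : H × E → V) : Prop :=
  ContDiff ℝ 2 S ∧
    ∀ B : Set (H × E), Bornology.IsBounded B →
      ∃ C : ℝ, ∀ p ∈ B, ∀ i : ℕ, i ≤ 2 → ‖iteratedFDeriv ℝ i S p‖ ≤ C

/-- Decomposability and non-degeneracy of the noise: `η_k = ∑_j b_j ξ_{jk} e_j` almost surely, with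
an orthonormal basis `e`, nonzero square-summable `b`, and independent `ξ_{jk}` bounded by `1`
whose law has a Lipschitz density `ρ_j` with `ρ_j(0) ≠ 0`. -/
def DecomposableNoise [MeasurableSpace Ω] (P : Measure Ω) (η : ℕ → Ω → E) : Prop :=
  ∃ (e : HilbertBasis ℕ ℝ E) (b : ℕ → ℝ) (ξ : ℕ × ℕ → Ω → ℝ) (ρ : ℕ → ℝ → ℝ),
    (∀ j, b j ≠ 0) ∧
    Summable (fun j => b j ^ 2) ∧
    (∀ i, Measurable (ξ i)) ∧
    iIndepFun ξ P ∧
    (∀ i, ∀ᵐ ω ∂P, |ξ i ω| ≤ 1) ∧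
    (∀ j, (∀ r, 0 ≤ ρ j r) ∧ (∃ L, LipschitzWith L (ρ j)) ∧ ρ j 0 ≠ 0) ∧
    (∀ j k, P.map (ξ (j, k)) = volume.withDensity (fun r => ENNReal.ofReal (ρ j r))) ∧
    (∀ k, ∀ᵐ ω ∂P, HasSum (fun j => (b j * ξ (j, k) ω) • e j) (η k ω))

/-- Dissipativity, with `K` the support of the law of the noise. -/
def Dissipative (ι : V →L[ℝ] H) (S : H × E → V) (K : Set E) : Prop :=
  ∃ γ β : ℝ, 0 < γ ∧ γ < 1 ∧ 0 < β ∧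
    ∀ u : H, (∀ ζ ∈ K, ‖ι (S (u, ζ))‖ ≤ γ * ‖u‖ + β) ∧ ‖ι (S (u, 0))‖ ≤ γ * ‖u‖

/-- Non-degeneracy: for `u ∈ H` and `ζ ∈ K` the image of the partial derivative
`D_η S(u, ζ) : E → V` is dense in `H`. -/
def Nondegenerate (ι : V →L[ℝ] H) (S : H × E → V) (K : Set E) : Prop :=
  ∀ u : H, ∀ ζ ∈ K, DenseRange (fun h : E => ι (fderiv ℝ (fun ζ' : E => S (u, ζ')) ζ h))

end System

end RDS

end

/-!
Write `F = ι ∘ S` and let `Q` be the one-step Markov operator. The directions along which the law of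
the noise moves Lipschitz-continuously in total variation form a subspace of `E`; it contains every
`e_j`, because the `j`-th coordinate has a Lipschitz density, so it is dense. Since `D_u F` is
compact and `D_η F` has dense range, a displacement of the state is compensated, up to a small
error, by a shift of the noise along one of finitely many of these directions, uniformly on compact
sets. Shifting the noise accordingly gives `|Q g u - Q g u'| ≤ (C * sup |g| + ε * Lip g) * ‖u - u'‖`
with `ε` arbitrarily small.

Hence, for the truncated metric `min 1 (‖x - y‖ / δ)` with `δ` small, `Q` halves Lipschitz constants
at distances below `δ`. At larger distances, `0 ∈ supp ℓ` and dissipativity bring both trajectories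
close to the origin, hence to each other, with positive probability after finitely many steps.
Together these make a power of `Q` a strict contraction of Lipschitz constants on a compact
invariant set, which the trajectories starting from the given ball enter in one step.
-/

namespace RDS

open Filter Topology
open scoped NNReal ENNReal BoundedContinuousFunction

lemma integral_norm_translate_sub_le {E : Type*} [NormedAddCommGroup E] [MeasurableSpace E]
    [BorelSpace E] {ν : Measure E} [ν.IsAddRightInvariant] [IsFiniteMeasureOnCompacts ν]
    {F : Type*} [NormedAddCommGroup F] {f : E → F} {L : ℝ≥0} (hf : LipschitzWith L f)
    (hsupp : HasCompactSupport f) (g : E) :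
    ∫ x, ‖f (x + g) - f x‖ ∂ν ≤ L * ‖g‖ * (2 * ν.real (tsupport f)) := by
  set s := tsupport f
  set s' := (fun x => x + g) ⁻¹' s
  have hs : ν s < ∞ := hsupp.isCompact.measure_lt_top
  have hs' : ν s' = ν s := measure_preimage_add_right ν g s
  have hzero : ∀ x ∉ s ∪ s', ‖f (x + g) - f x‖ = 0 := fun x hx => by
    rw [mem_union, not_or] at hx
    rw [image_eq_zero_of_notMem_tsupport hx.1, image_eq_zero_of_notMem_tsupport hx.2, sub_zero,
      norm_zero]
  have hbound : ∀ x, ‖‖f (x + g) - f x‖‖ ≤ L * ‖g‖ := fun x => by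
    simpa only [norm_norm, dist_eq_norm, add_sub_cancel_left] using hf.dist_le_mul (x + g) x
  calc ∫ x, ‖f (x + g) - f x‖ ∂ν = ∫ x in s ∪ s', ‖f (x + g) - f x‖ ∂ν :=
        (setIntegral_eq_integral_of_forall_compl_eq_zero hzero).symm
    _ ≤ L * ‖g‖ * ν.real (s ∪ s') :=
      (le_abs_self _).trans (norm_setIntegral_le_of_norm_le_const
        (measure_union_lt_top hs (hs'.trans_lt hs)) fun x _ => hbound x)
    _ ≤ L * ‖g‖ * (ν.real s + ν.real s') := by
      gcongr
      exact measureReal_union_le s s'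
    _ = L * ‖g‖ * (2 * ν.real s) := by rw [measureReal_def ν s', hs', ← measureReal_def, two_mul]

section TranslationLipschitz

variable {E : Type*} [NormedAddCommGroup E] [NormedSpace ℝ E] [MeasurableSpace E]

/-- The total variation distance between `μ` and its translate by `t • h` is at most `C * |t|`.
Total variation is tested on bounded continuous functions. -/
def TranslationLipschitzWith (C : ℝ≥0) (μ : Measure E) (h : E) : Prop :=
  ∀ (t : ℝ) (G : E →ᵇ ℝ), |∫ x, G (x + t • h) ∂μ - ∫ x, G x ∂μ| ≤ C * |t| * ‖G‖

variable {μ : Measure E} {C : ℝ≥0} {h : E}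

namespace TranslationLipschitzWith

lemma zero (μ : Measure E) : TranslationLipschitzWith 0 μ (0 : E) := fun t G => by simp

lemma smul (hμ : TranslationLipschitzWith C μ h) (a : ℝ) :
    TranslationLipschitzWith (C * ‖a‖₊) μ (a • h) := fun t G => by
  have key := hμ (t * a) G
  rw [abs_mul, mul_smul] at key
  calc |∫ x, G (x + t • a • h) ∂μ - ∫ x, G x ∂μ| ≤ C * (|t| * |a|) * ‖G‖ := key
    _ = ↑(C * ‖a‖₊) * |t| * ‖G‖ := by
      rw [NNReal.coe_mul, coe_nnnorm, Real.norm_eq_abs]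
      ring

lemma add {C' : ℝ≥0} {h' : E} (hμ : TranslationLipschitzWith C μ h)
    (hμ' : TranslationLipschitzWith C' μ h') : TranslationLipschitzWith (C + C') μ (h + h') :=
  fun t G => by
    set G' : E →ᵇ ℝ := G.compContinuous ⟨fun x => x + t • h', by fun_prop⟩
    have hG' : ‖G'‖ ≤ ‖G‖ := G.norm_compContinuous_le _
    have hshift : ∀ x, G (x + t • (h + h')) = G' (x + t • h) := fun x => by
      simp only [G', BoundedContinuousFunction.compContinuous_apply, ContinuousMap.coe_mk,
        smul_add, add_assoc]
    calc |∫ x, G (x + t • (h + h')) ∂μ - ∫ x, G x ∂μ|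
        ≤ |∫ x, G' (x + t • h) ∂μ - ∫ x, G' x ∂μ| + |∫ x, G' x ∂μ - ∫ x, G x ∂μ| := by
          simp only [hshift]
          exact abs_sub_le _ _ _
      _ ≤ C * |t| * ‖G'‖ + C' * |t| * ‖G‖ := add_le_add (hμ t G') (hμ' t G)
      _ ≤ C * |t| * ‖G‖ + C' * |t| * ‖G‖ := by gcongr
      _ = ↑(C + C') * |t| * ‖G‖ := by
        rw [NNReal.coe_add]
        ring

variable [BorelSpace E]

lemma map {F : Type*} [NormedAddCommGroup F] [NormedSpace ℝ F] [MeasurableSpace F] [BorelSpace F]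
    (hμ : TranslationLipschitzWith C μ h) (A : E →L[ℝ] F) :
    TranslationLipschitzWith C (μ.map A) (A h) := fun t G => by
  set G' : E →ᵇ ℝ := G.compContinuous ⟨A, A.continuous⟩
  have hshift : Measurable fun x => G (x + t • A h) := by fun_prop
  rw [integral_map A.measurable.aemeasurable hshift.stronglyMeasurable.aestronglyMeasurable,
    integral_map A.measurable.aemeasurable G.continuous.stronglyMeasurable.aestronglyMeasurable]
  calc |∫ x, G (A x + t • A h) ∂μ - ∫ x, G (A x) ∂μ|
      = |∫ x, G' (x + t • h) ∂μ - ∫ x, G' x ∂μ| := by simp [G']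
    _ ≤ C * |t| * ‖G'‖ := hμ t G'
    _ ≤ C * |t| * ‖G‖ := by
      gcongr
      exact G.norm_compContinuous_le _

lemma conv [SecondCountableTopology E] [IsFiniteMeasure μ] (ν : Measure E)
    [IsProbabilityMeasure ν] (hμ : TranslationLipschitzWith C μ h) :
    TranslationLipschitzWith C (ν.conv μ) h := fun t G => by
  set Gt : E →ᵇ ℝ := G.compContinuous ⟨fun x => x + t • h, by fun_prop⟩
  have hint : ∀ G : E →ᵇ ℝ, Integrable (fun x => ∫ y, G (x + y) ∂μ) ν := fun G =>
    (((G.integrable (ν.conv μ)).comp_measurable (measurable_fst.add measurable_snd)) :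
      Integrable (fun p : E × E => G (p.1 + p.2)) (ν.prod μ)).integral_prod_left
  have hfiber : ∀ x, ‖∫ y, Gt (x + y) ∂μ - ∫ y, G (x + y) ∂μ‖ ≤ C * |t| * ‖G‖ := fun x => by
    set Gx : E →ᵇ ℝ := G.compContinuous ⟨fun y => x + y, by fun_prop⟩
    calc ‖∫ y, Gt (x + y) ∂μ - ∫ y, G (x + y) ∂μ‖
        = |∫ y, Gx (y + t • h) ∂μ - ∫ y, Gx y ∂μ| := by simp [Gx, Gt, add_assoc]
      _ ≤ C * |t| * ‖Gx‖ := hμ t Gx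
      _ ≤ C * |t| * ‖G‖ := by
        gcongr
        exact G.norm_compContinuous_le _
  calc |∫ x, Gt x ∂(ν.conv μ) - ∫ x, G x ∂(ν.conv μ)|
      = |∫ x, (∫ y, Gt (x + y) ∂μ - ∫ y, G (x + y) ∂μ) ∂ν| := by
        rw [integral_conv (Gt.integrable _), integral_conv (G.integrable _),
          integral_sub (hint Gt) (hint G)]
    _ ≤ C * |t| * ‖G‖ := by
      simpa using norm_integral_le_of_norm_le_const (μ := ν) (ae_of_all _ hfiber)

lemma of_tendsto {Ω : Type*} [MeasurableSpace Ω] {P : Measure Ω} [IsFiniteMeasure P]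
    {X : ℕ → Ω → E} {Y : Ω → E} (hX : ∀ n, AEMeasurable (X n) P) (hY : AEMeasurable Y P)
    (hlim : ∀ᵐ ω ∂P, Tendsto (fun n => X n ω) atTop (𝓝 (Y ω)))
    (hTL : ∀ᶠ n in atTop, TranslationLipschitzWith C (P.map (X n)) h) :
    TranslationLipschitzWith C (P.map Y) h := fun t G => by
  have hconv : ∀ G : E →ᵇ ℝ,
      Tendsto (fun n => ∫ x, G x ∂P.map (X n)) atTop (𝓝 (∫ x, G x ∂P.map Y)) := fun G => by
    have hm : ∀ ν : Measure E, AEStronglyMeasurable G ν := fun ν =>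
      G.continuous.stronglyMeasurable.aestronglyMeasurable
    simp only [integral_map (hX _) (hm _), integral_map hY (hm _)]
    refine tendsto_integral_of_dominated_convergence (fun _ => ‖G‖)
      (fun n => (hm _).comp_aemeasurable (hX n)) (integrable_const _)
      (fun n => ae_of_all _ fun ω => G.norm_coe_le_norm _) ?_
    filter_upwards [hlim] with ω hω using (G.continuous.tendsto _).comp hω
  exact le_of_tendsto
    ((hconv (G.compContinuous ⟨fun x => x + t • h, by fun_prop⟩)).sub (hconv G)).abs
    (hTL.mono fun n hn => hn t G)

lemma withDensity [IsFiniteMeasure μ] (hμ : TranslationLipschitzWith C μ h) {ψ : E → ℝ≥0}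
    {Λ : ℝ≥0} (hψ : LipschitzWith Λ ψ) (hψ1 : ∀ x, ψ x ≤ 1) :
    TranslationLipschitzWith (C + Λ * ‖h‖₊ * (μ univ).toNNReal)
      (μ.withDensity fun x => ψ x) h := fun t G => by
  have hψc : Continuous fun x => (ψ x : ℝ) := NNReal.continuous_coe.comp hψ.continuous
  set ψG : E →ᵇ ℝ := BoundedContinuousFunction.ofNormedAddCommGroup (fun x => ψ x * G x)
    (hψc.mul G.continuous) ‖G‖ fun x => by
      rw [norm_mul, NNReal.norm_eq]
      exact (mul_le_mul (NNReal.coe_le_one.2 (hψ1 x)) (G.norm_coe_le_norm x) (norm_nonneg _)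
        zero_le_one).trans_eq (one_mul _)
  have hψG : ‖ψG‖ ≤ ‖G‖ :=
    BoundedContinuousFunction.norm_ofNormedAddCommGroup_le _ (norm_nonneg G) _
  set Gt : E →ᵇ ℝ := G.compContinuous ⟨fun x => x + t • h, by fun_prop⟩
  set ψGt : E →ᵇ ℝ := ψG.compContinuous ⟨fun x => x + t • h, by fun_prop⟩
  have hψGt : Integrable (fun x => ψ x * Gt x) μ :=
    (Gt.integrable μ).bdd_mul hψc.stronglyMeasurable.aestronglyMeasurable
      (ae_of_all _ fun x => (NNReal.norm_eq (ψ x)).trans_le (NNReal.coe_le_one.2 (hψ1 x)))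
  have hcommutator : ‖∫ x, (ψ x * Gt x - ψGt x) ∂μ‖ ≤ Λ * (|t| * ‖h‖) * ‖G‖ * μ.real univ := by
    refine norm_integral_le_of_norm_le_const (ae_of_all _ fun x => ?_)
    calc ‖ψ x * Gt x - ψGt x‖ = dist (ψ x) (ψ (x + t • h)) * ‖Gt x‖ := by
          rw [show ψ x * Gt x - ψGt x = ((ψ x : ℝ) - ψ (x + t • h)) * Gt x from (sub_mul ..).symm,
            norm_mul, NNReal.dist_eq, Real.norm_eq_abs]
      _ ≤ Λ * (|t| * ‖h‖) * ‖G‖ := by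
          refine mul_le_mul ((hψ.dist_le_mul _ _).trans_eq ?_) (G.norm_coe_le_norm _)
            (norm_nonneg _) (by positivity)
          rw [dist_self_add_right, norm_smul, Real.norm_eq_abs]
  simp only [integral_withDensity_eq_integral_smul hψ.continuous.measurable, NNReal.smul_def,
    smul_eq_mul]
  calc |∫ x, ψ x * Gt x ∂μ - ∫ x, ψG x ∂μ|
      = |∫ x, (ψ x * Gt x - ψGt x) ∂μ + (∫ x, ψGt x ∂μ - ∫ x, ψG x ∂μ)| := by
        rw [integral_sub hψGt (ψGt.integrable μ), sub_add_sub_cancel]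
    _ ≤ Λ * (|t| * ‖h‖) * ‖G‖ * μ.real univ + C * |t| * ‖ψG‖ :=
      (abs_add_le _ _).trans (add_le_add hcommutator (hμ t ψG))
    _ ≤ Λ * (|t| * ‖h‖) * ‖G‖ * μ.real univ + C * |t| * ‖G‖ := by gcongr
    _ = ↑(C + Λ * ‖h‖₊ * (μ univ).toNNReal) * |t| * ‖G‖ := by
      rw [NNReal.coe_add, NNReal.coe_mul, NNReal.coe_mul, coe_nnnorm,
        show ((μ univ).toNNReal : ℝ) = μ.real univ from rfl]
      ring

end TranslationLipschitzWith

/-- The directions along which `μ` is Lipschitz under translations in total variation. -/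
def translationLipschitzSubspace (μ : Measure E) : Submodule ℝ E where
  carrier := {h | ∃ C, TranslationLipschitzWith C μ h}
  add_mem' := fun ⟨_, h⟩ ⟨_, h'⟩ => ⟨_, h.add h'⟩
  zero_mem' := ⟨0, .zero μ⟩
  smul_mem' := fun a _ ⟨_, h⟩ => ⟨_, h.smul a⟩

lemma exists_forall_translationLipschitzWith {T : Finset E}
    (hT : (T : Set E) ⊆ translationLipschitzSubspace μ) :
    ∃ C : ℝ≥0, ∀ h ∈ T, TranslationLipschitzWith C μ h := by
  choose! C hC using fun h (hh : h ∈ T) => hT hh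
  refine ⟨T.sup C, fun h hh t G => (hC h hh t G).trans ?_⟩
  have hle : (C h : ℝ) ≤ (T.sup C : ℝ≥0) := NNReal.coe_le_coe.2 (Finset.le_sup hh)
  gcongr

lemma translationLipschitzSubspace_le_withDensity [BorelSpace E] [IsFiniteMeasure μ] {ψ : E → ℝ≥0}
    {Λ : ℝ≥0} (hψ : LipschitzWith Λ ψ) (hψ1 : ∀ x, ψ x ≤ 1) :
    translationLipschitzSubspace μ ≤ translationLipschitzSubspace (μ.withDensity fun x => ψ x) :=
  fun _ ⟨_, hC⟩ => ⟨_, hC.withDensity hψ hψ1⟩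

lemma translationLipschitzSubspace_withDensity_eq_top [BorelSpace E]
    (ν : Measure E) [ν.IsAddRightInvariant] [IsFiniteMeasureOnCompacts ν] {ρ : E → ℝ≥0} {L : ℝ≥0}
    (hρ : LipschitzWith L ρ) (hsupp : HasCompactSupport ρ) :
    translationLipschitzSubspace (ν.withDensity fun x => ρ x) = ⊤ := by
  set f : E → ℝ := fun x => ρ x
  have hf : LipschitzWith L f := .of_dist_le_mul hρ.dist_le_mul
  have hfsupp : HasCompactSupport f := hsupp.comp_left NNReal.coe_zero
  have hfint : Integrable f ν := hf.continuous.integrable_of_hasCompactSupport hfsupp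
  refine eq_top_iff.2 fun h _ => ⟨L * ‖h‖₊ * (2 * (ν (tsupport f)).toNNReal), fun t G => ?_⟩
  set g := -(t • h)
  have hmul : ∀ {φ : E → ℝ}, Integrable φ ν → Integrable (fun x => φ x * G x) ν := fun hφ =>
    hφ.mul_bdd G.continuous.stronglyMeasurable.aestronglyMeasurable (ae_of_all _ G.norm_coe_le_norm)
  have hchange : ∫ x, f x * G (x + t • h) ∂ν = ∫ x, f (x + g) * G x ∂ν := by
    simpa [g] using
      integral_add_right_eq_self (μ := ν) (fun x => f (x + g) * G x) (t • h)
  have hdiff : Integrable (fun x => f (x + g) - f x) ν := (hfint.comp_add_right g).sub hfint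
  simp only [integral_withDensity_eq_integral_smul hρ.continuous.measurable, NNReal.smul_def,
    smul_eq_mul]
  calc |∫ x, f x * G (x + t • h) ∂ν - ∫ x, f x * G x ∂ν|
      = ‖∫ x, (f (x + g) - f x) * G x ∂ν‖ := by
        simp only [hchange, sub_mul, integral_sub (hmul (hfint.comp_add_right g)) (hmul hfint),
          Real.norm_eq_abs]
    _ ≤ ∫ x, ‖f (x + g) - f x‖ * ‖G‖ ∂ν :=
      norm_integral_le_of_norm_le (hdiff.norm.mul_const _) (ae_of_all _ fun x =>
        (norm_mul_le _ _).trans (by gcongr; exact G.norm_coe_le_norm x))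
    _ ≤ L * ‖g‖ * (2 * ν.real (tsupport f)) * ‖G‖ := by
      rw [integral_mul_const]
      gcongr
      exact integral_norm_translate_sub_le hf hfsupp g
    _ = ↑(L * ‖h‖₊ * (2 * (ν (tsupport f)).toNNReal)) * |t| * ‖G‖ := by
      simp only [g, norm_neg, norm_smul, Real.norm_eq_abs, NNReal.coe_mul, coe_nnnorm,
        NNReal.coe_ofNat, show ((ν (tsupport f)).toNNReal : ℝ) = ν.real (tsupport f) from rfl]
      ring

end TranslationLipschitz

section Density

variable {X : Type*} [TopologicalSpace X] [MeasurableSpace X] [OpensMeasurableSpace X]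
  {ν : Measure X} [ν.IsOpenPosMeasure] {ρ : X → ℝ≥0}

lemma support_subset_support_withDensity (hρ : Continuous ρ) :
    Function.support ρ ⊆ (ν.withDensity fun x => ρ x).support := fun x hx => by
  refine (Measure.mem_support_iff_forall _).2 fun U hU => ?_
  have hopen : IsOpen (Function.support ρ ∩ interior U) := hρ.isOpen_support.inter isOpen_interior
  calc 0 < ∫⁻ x in Function.support ρ ∩ interior U, ρ x ∂ν := by
        rw [setLIntegral_pos_iff hρ.measurable.coe_nnreal_ennreal]
        refine (hopen.measure_pos ν ⟨x, hx, mem_interior_iff_mem_nhds.2 hU⟩).trans_le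
          (measure_mono fun y hy => ⟨?_, hy⟩)
        simpa using hy.1
    _ = ν.withDensity (fun x => ρ x) (Function.support ρ ∩ interior U) :=
      (withDensity_apply _ hopen.measurableSet).symm
    _ ≤ ν.withDensity (fun x => ρ x) U :=
      measure_mono (inter_subset_right.trans interior_subset)

lemma hasCompactSupport_of_mem_ae_withDensity [T2Space X] (hρ : Continuous ρ) {s : Set X}
    (hs : IsCompact s) (hsρ : s ∈ ae (ν.withDensity fun x => ρ x)) : HasCompactSupport ρ :=
  .of_support_subset_isCompact hs <| (support_subset_support_withDensity hρ).trans <|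
    Measure.support_subset_of_isClosed hs.isClosed hsρ

end Density

section IndependentSeries

variable {Ω : Type*} [MeasurableSpace Ω] {P : Measure Ω}

lemma measure_preimage_pos_of_forall_mem_support {ι : Type*} {X : ι → Type*}
    [∀ i, TopologicalSpace (X i)] [∀ i, MeasurableSpace (X i)] [∀ i, OpensMeasurableSpace (X i)]
    {ξ : ∀ i, Ω → X i} (hξ : ∀ i, Measurable (ξ i)) (hind : iIndepFun ξ P) {x : ∀ i, X i}
    (hx : ∀ i, x i ∈ (P.map (ξ i)).support) {U : Set (∀ i, X i)} (hU : IsOpen U) (hxU : x ∈ U) :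
    0 < P {ω | (fun i => ξ i ω) ∈ U} := by
  obtain ⟨I, u, hu, hbox⟩ := isOpen_pi_iff.1 hU x hxU
  have hpos : 0 < P (⋂ i ∈ I, ξ i ⁻¹' u i) := by
    rw [hind.measure_inter_preimage_eq_mul I fun i hi => (hu i hi).1.measurableSet, pos_iff_ne_zero,
      Finset.prod_ne_zero_iff]
    intro i hi
    rw [← Measure.map_apply (hξ i) (hu i hi).1.measurableSet]
    exact ((Measure.mem_support_iff_forall _).1 (hx i) _ ((hu i hi).1.mem_nhds (hu i hi).2)).ne'
  exact hpos.trans_le (measure_mono fun ω hω => hbox fun i hi => mem_iInter₂.1 hω i hi)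

lemma mem_translationLipschitzSubspace_map_of_hasSum [IsProbabilityMeasure P] {E : Type*}
    [NormedAddCommGroup E] [NormedSpace ℝ E] [MeasurableSpace E] [BorelSpace E]
    [SecondCountableTopology E] {X : ℕ → Ω → E} (hX : ∀ j, Measurable (X j)) (hind : iIndepFun X P)
    {Y : Ω → E} (hY : AEMeasurable Y P) (hsum : ∀ᵐ ω ∂P, HasSum (fun j => X j ω) (Y ω)) {m : ℕ}
    {h : E} (hh : h ∈ translationLipschitzSubspace (P.map (X m))) :
    h ∈ translationLipschitzSubspace (P.map Y) := by
  obtain ⟨C, hC⟩ := hh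
  have hmeas : ∀ s : Finset ℕ, Measurable (∑ j ∈ s, X j) := fun s => by
    simpa only [Finset.sum_fn] using Finset.measurable_sum s fun j _ => hX j
  have hprob : ∀ {Z : Ω → E}, Measurable Z → IsProbabilityMeasure (P.map Z) := fun hZ =>
    Measure.isProbabilityMeasure_map hZ.aemeasurable
  refine ⟨C, .of_tendsto (X := fun n => ∑ j ∈ Finset.range n, X j)
    (fun n => (hmeas _).aemeasurable) hY ?_ ?_⟩
  · filter_upwards [hsum] with ω hω
    simpa only [Finset.sum_apply] using hω.tendsto_sum_nat
  · filter_upwards [eventually_gt_atTop m] with n hn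
    set s := (Finset.range n).erase m
    have := hprob (hX m)
    have := hprob (hmeas s)
    have hlaw : P.map (∑ j ∈ Finset.range n, X j) = (P.map (∑ j ∈ s, X j)).conv (P.map (X m)) := by
      rw [← Finset.sum_erase_add _ _ (Finset.mem_range.2 hn)]
      exact (hind.indepFun_finsetSum_of_notMem hX (Finset.notMem_erase m _)).map_add_eq_map_conv_map
        (hmeas s) (hX m)
    rw [hlaw]
    exact hC.conv _

lemma hasSum_sq_of_hasSum_smul {ι E : Type*} [NormedAddCommGroup E]
    [InnerProductSpace ℝ E] {e : ι → E} (he : Orthonormal ℝ e) {a : ι → ℝ} {z : E}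
    (h : HasSum (fun j => a j • e j) z) : HasSum (fun j => a j ^ 2) (‖z‖ ^ 2) := by
  refine (h.norm.pow 2).congr fun s => ?_
  rw [← real_inner_self_eq_norm_sq, he.inner_sum]
  simp [sq]

lemma zero_mem_support_map_of_hasSum_smul {E : Type*} [NormedAddCommGroup E]
    [InnerProductSpace ℝ E] [MeasurableSpace E] [BorelSpace E] {e : ℕ → E} (he : Orthonormal ℝ e)
    {b : ℕ → ℝ} (hb : Summable fun j => b j ^ 2) {ξ : ℕ → Ω → ℝ} (hξ : ∀ j, Measurable (ξ j))
    (hind : iIndepFun ξ P) (hbdd : ∀ j, ∀ᵐ ω ∂P, |ξ j ω| ≤ 1)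
    (h0 : ∀ j, (0 : ℝ) ∈ (P.map (ξ j)).support) {Y : Ω → E} (hY : AEMeasurable Y P)
    (hsum : ∀ᵐ ω ∂P, HasSum (fun j => (b j * ξ j ω) • e j) (Y ω)) :
    (0 : E) ∈ (P.map Y).support := by
  refine (Measure.mem_support_iff_forall _).2 fun U hU => ?_
  obtain ⟨θ, hθ, hθU⟩ := Metric.mem_nhds_iff.1 hU
  -- Truncating the coordinates makes the squared norm continuous for the product topology.
  set f : (ℕ → ℝ) → ℝ := fun a => ∑' j, (b j * min 1 |a j|) ^ 2
  have hf : Continuous f := by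
    refine continuous_tsum (fun j => by fun_prop) hb fun j a => ?_
    rw [Real.norm_of_nonneg (sq_nonneg _), mul_pow]
    refine mul_le_of_le_one_right (sq_nonneg _) (pow_le_one₀ (by positivity) (min_le_left _ _))
  have hf0 : f 0 < θ ^ 2 := by simpa [f] using pow_pos hθ 2
  have hpos := measure_preimage_pos_of_forall_mem_support hξ hind (x := 0) h0
    (hf.isOpen_preimage _ isOpen_Iio) hf0
  refine hpos.trans_le (((measure_mono_ae ?_).trans
    (Measure.le_map_apply hY (Metric.ball 0 θ))).trans (measure_mono hθU))
  filter_upwards [ae_all_iff.2 hbdd, hsum] with ω hω hYω hfω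
  have hnorm : f (fun j => ξ j ω) = ‖Y ω‖ ^ 2 := by
    rw [← (hasSum_sq_of_hasSum_smul he hYω).tsum_eq]
    exact tsum_congr fun j => by rw [min_eq_right (hω j), mul_pow, mul_pow, sq_abs]
  exact mem_ball_zero_iff.2 (lt_of_pow_lt_pow_left₀ 2 hθ.le (hnorm.symm.trans_lt hfω))

end IndependentSeries

section Decomposable

variable {Ω E : Type*} [MeasurableSpace Ω] {P : Measure Ω} [NormedAddCommGroup E]
  [InnerProductSpace ℝ E] [MeasurableSpace E] [BorelSpace E] {η : ℕ → Ω → E}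

lemma DecomposableNoise.zero_mem_support (hη : DecomposableNoise P η) {k : ℕ}
    (hm : AEMeasurable (η k) P) : (0 : E) ∈ (P.map (η k)).support := by
  obtain ⟨e, b, ξ, ρ, -, hb, hξ, hind, hbdd, hρ, hlaw, hsum⟩ := hη
  refine zero_mem_support_map_of_hasSum_smul e.orthonormal hb (fun j => hξ (j, k))
    (hind.precomp (Prod.mk_left_injective k)) (fun j => hbdd (j, k)) (fun j => ?_) hm (hsum k)
  obtain ⟨hρ0, ⟨L, hL⟩, hne⟩ := hρ j
  rw [hlaw]
  exact support_subset_support_withDensity (continuous_real_toNNReal.comp hL.continuous)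
    (Real.toNNReal_pos.2 ((hρ0 0).lt_of_ne' hne)).ne'

lemma DecomposableNoise.dense_translationLipschitzSubspace [IsProbabilityMeasure P]
    [SecondCountableTopology E] (hη : DecomposableNoise P η) {k : ℕ} (hm : AEMeasurable (η k) P) :
    Dense (translationLipschitzSubspace (P.map (η k)) : Set E) := by
  obtain ⟨e, b, ξ, ρ, hb, -, hξ, hind, hbdd, hρ, hlaw, hsum⟩ := hη
  have htop : ∀ j, translationLipschitzSubspace (P.map (ξ (j, k))) = ⊤ := fun j => by
    obtain ⟨-, ⟨L, hL⟩, -⟩ := hρ j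
    have hL' : LipschitzWith L fun r => (ρ j r).toNNReal := by
      simpa [Function.comp_def] using Real.lipschitzWith_toNNReal.comp hL
    have hIcc : Icc (-1) 1 ∈ ae (P.map (ξ (j, k))) :=
      (ae_map_iff (hξ _).aemeasurable measurableSet_Icc).2 ((hbdd (j, k)).mono fun ω => abs_le.1)
    rw [hlaw] at hIcc ⊢
    exact translationLipschitzSubspace_withDensity_eq_top _ hL'
      (hasCompactSupport_of_mem_ae_withDensity hL'.continuous isCompact_Icc hIcc)
  have hmem : ∀ j, e j ∈ translationLipschitzSubspace (P.map (η k)) := fun j => by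
    set A : ℕ → ℝ →L[ℝ] E := fun j => ContinuousLinearMap.toSpanSingleton ℝ (b j • e j)
    have hA : ∀ i, Measurable fun ω => A i (ξ (i, k) ω) := fun i => (A i).measurable.comp (hξ _)
    obtain ⟨C, hC⟩ : (1 : ℝ) ∈ translationLipschitzSubspace (P.map (ξ (j, k))) :=
      htop j ▸ Submodule.mem_top
    have hAj : A j 1 ∈ translationLipschitzSubspace (P.map fun ω => A j (ξ (j, k) ω)) :=
      ⟨C, Measure.map_map (A j).measurable (hξ _) ▸ hC.map (A j)⟩
    have hbe := mem_translationLipschitzSubspace_map_of_hasSum hA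
      ((hind.precomp (Prod.mk_left_injective k)).comp (fun i => A i) fun i => (A i).measurable) hm
      ((hsum k).mono fun ω hω => by simpa [A, smul_smul, mul_comm] using hω) hAj
    simpa [A, smul_smul, hb j] using Submodule.smul_mem _ (b j)⁻¹ hbe
  refine Submodule.dense_iff_topologicalClosure_eq_top.2 (top_unique ?_)
  rw [← e.dense_span]
  exact Submodule.topologicalClosure_mono (Submodule.span_le.2 (range_subset_iff.2 hmem))

end Decomposable

section Control

variable {H E G : Type*} [NormedAddCommGroup H] [NormedSpace ℝ H] [NormedAddCommGroup E]
  [NormedSpace ℝ E] [NormedAddCommGroup G] [NormedSpace ℝ G]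

lemma exists_finset_norm_add_lt {A : H →L[ℝ] G} (hA : IsCompactOperator A) {B : E →L[ℝ] G}
    (hB : DenseRange B) {D : Set E} (hD : Dense D) {ε : ℝ} (hε : 0 < ε) :
    ∃ T : Finset E, ↑T ⊆ D ∧ ∀ v : H, ‖v‖ ≤ 1 → ∃ h ∈ T, ‖A v + B h‖ < ε := by
  have hcompact : IsCompact (closure (A '' Metric.closedBall 0 1)) :=
    hA.isCompact_closure_image_closedBall (f := (A : H →ₗ[ℝ] G)) 1
  obtain ⟨T, hTD, hTfin, hcover⟩ := hcompact.elim_finite_subcover_image (b := D)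
    (c := fun h => Metric.ball (-B h) ε) (fun _ _ => Metric.isOpen_ball) fun w _ => by
      obtain ⟨_, hlt, h, hh, rfl⟩ :=
        Metric.dense_iff.1 (hB.dense_image B.continuous hD) (-w) ε hε
      exact mem_iUnion₂.2 ⟨h, hh, by
        rwa [Metric.mem_ball, ← dist_neg_neg, neg_neg, dist_comm, ← Metric.mem_ball]⟩
  refine ⟨hTfin.toFinset, by simpa using hTD, fun v hv => ?_⟩
  obtain ⟨h, hh, hvh⟩ := mem_iUnion₂.1 (hcover (subset_closure
    ⟨v, mem_closedBall_zero_iff.2 hv, rfl⟩))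
  exact ⟨h, hTfin.mem_toFinset.2 hh, by simpa [dist_eq_norm] using hvh⟩

/-- `T` is a set of approximate controls for `F` on `Z`: near every point of `Z`, on a scale `r`,
the effect of a unit perturbation `v` of the state is compensated up to `ε` by moving the noise in
one of the directions `h ∈ T`. -/
def IsControlSet (F : H × E → G) (Z : Set (H × E)) (T : Set E) (ε r : ℝ) : Prop :=
  ∀ p ∈ Z, ∀ v : H, ‖v‖ ≤ 1 → ∃ h ∈ T, ∀ q ∈ Metric.ball p r, ‖fderiv ℝ F q (v, h)‖ ≤ ε

lemma IsControlSet.mono {F : H × E → G} {Z Z' : Set (H × E)} {T T' : Set E} {ε r r' : ℝ}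
    (h : IsControlSet F Z T ε r) (hZ : Z' ⊆ Z) (hT : T ⊆ T') (hr : r' ≤ r) :
    IsControlSet F Z' T' ε r' := fun p hp v hv =>
  let ⟨w, hw, hq⟩ := h p (hZ hp) v hv
  ⟨w, hT hw, fun q hqp => hq q (Metric.ball_subset_ball hr hqp)⟩

variable {F : H × E → G} {D : Set E} {ε : ℝ}

lemma exists_isControlSet_ball (hF : ContDiff ℝ 1 F) {p : H × E}
    (hcomp : IsCompactOperator fun v : H => fderiv ℝ F p (v, 0))
    (hdense : DenseRange fun h : E => fderiv ℝ F p (0, h)) (hD : Dense D) (hε : 0 < ε) :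
    ∃ T : Finset E, ↑T ⊆ D ∧ ∃ r > 0, IsControlSet F (Metric.ball p r) T ε r := by
  obtain ⟨T, hTD, hT⟩ := exists_finset_norm_add_lt
    (A := (fderiv ℝ F p).comp (.inl ℝ H E)) (B := (fderiv ℝ F p).comp (.inr ℝ H E))
    hcomp hdense hD (half_pos hε)
  obtain ⟨J, hJ0, hJ⟩ := T.finite_toSet.isBounded.exists_pos_norm_le
  obtain ⟨r, hr, hrF⟩ := Metric.continuousAt_iff.1
    (hF.continuous_fderiv one_ne_zero).continuousAt (ε / 2 / (1 + J)) (by positivity)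
  refine ⟨T, hTD, r / 2, half_pos hr, fun p' hp' v hv => ?_⟩
  obtain ⟨h, hh, hvh⟩ := hT v hv
  refine ⟨h, hh, fun q hq => ?_⟩
  have hqp : dist q p < r := by
    linarith [dist_triangle q p' p, Metric.mem_ball.1 hq, Metric.mem_ball.1 hp']
  have hnorm : ‖(v, h)‖ ≤ 1 + J := max_le (by linarith) (by linarith [hJ h hh])
  have hp : fderiv ℝ F p (v, h) = fderiv ℝ F p (v, 0) + fderiv ℝ F p (0, h) := by
    rw [← map_add, Prod.mk_add_mk, add_zero, zero_add]
  calc ‖fderiv ℝ F q (v, h)‖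
      = ‖(fderiv ℝ F q - fderiv ℝ F p) (v, h)
          + (fderiv ℝ F p (v, 0) + fderiv ℝ F p (0, h))‖ := by
        rw [← hp, sub_apply, sub_add_cancel]
    _ ≤ ε / 2 / (1 + J) * (1 + J) + ε / 2 := by
      refine (norm_add_le _ _).trans (add_le_add (ContinuousLinearMap.le_of_opNorm_le_of_le _
        ?_ hnorm) hvh.le)
      exact (dist_eq_norm (fderiv ℝ F q) _ ▸ hrF hqp).le
    _ = ε := by
      field_simp
      ring

lemma exists_isControlSet (hF : ContDiff ℝ 1 F) {Z : Set (H × E)} (hZ : IsCompact Z)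
    (hcomp : ∀ p ∈ Z, IsCompactOperator fun v : H => fderiv ℝ F p (v, 0))
    (hdense : ∀ p ∈ Z, DenseRange fun h : E => fderiv ℝ F p (0, h)) (hD : Dense D)
    (hε : 0 < ε) : ∃ T : Finset E, ↑T ⊆ D ∧ ∃ r > 0, IsControlSet F Z T ε r := by
  classical
  refine hZ.induction_on (p := fun Z => ∃ T : Finset E, ↑T ⊆ D ∧ ∃ r > 0, IsControlSet F Z T ε r)
    ⟨∅, by simp, 1, one_pos, fun p hp => hp.elim⟩ ?_ ?_ fun p hp => ?_
  · rintro s s' hs ⟨T, hTD, r, hr, h⟩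
    exact ⟨T, hTD, r, hr, h.mono hs subset_rfl le_rfl⟩
  · rintro s s' ⟨T, hTD, r, hr, h⟩ ⟨T', hTD', r', hr', h'⟩
    refine ⟨T ∪ T', by simp [hTD, hTD'], min r r', lt_min hr hr', ?_⟩
    rintro p (hp | hp)
    · exact h.mono subset_rfl (by simp) (min_le_left r r') p hp
    · exact h'.mono subset_rfl (by simp) (min_le_right r r') p hp
  · obtain ⟨T, hTD, r, hr, h⟩ := exists_isControlSet_ball hF (hcomp p hp) (hdense p hp) hD hε
    exact ⟨_, mem_nhdsWithin_of_mem_nhds (Metric.ball_mem_nhds p hr), T, hTD, r, hr, h⟩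

end Control

lemma norm_map_add_smul_sub_le {X G : Type*} [NormedAddCommGroup X] [NormedSpace ℝ X]
    [NormedAddCommGroup G] [NormedSpace ℝ G] {F : X → G} {U : Set X} (hU : Convex ℝ U)
    (hF : ∀ q ∈ U, DifferentiableAt ℝ F q) {d : X} {ε : ℝ} (hd : ∀ q ∈ U, ‖fderiv ℝ F q d‖ ≤ ε)
    {p : X} (hp : p ∈ U) {s : ℝ} (hs : 0 ≤ s) (hps : p + s • d ∈ U) :
    ‖F (p + s • d) - F p‖ ≤ s * ε := by
  have hseg : ∀ σ ∈ Icc (0 : ℝ) 1, p + σ • s • d ∈ U := fun σ hσ => by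
    simpa using hU.add_smul_sub_mem hp hps hσ
  have hderiv : ∀ σ ∈ Icc (0 : ℝ) 1, HasDerivWithinAt (fun σ : ℝ => F (p + σ • s • d))
      (fderiv ℝ F (p + σ • s • d) (s • d)) (Icc 0 1) σ := fun σ hσ => by
    have hline : HasDerivAt (fun σ : ℝ => p + σ • s • d) (s • d) σ := by
      simpa using ((hasDerivAt_id σ).smul_const (s • d)).const_add p
    exact ((hF _ (hseg σ hσ)).hasFDerivAt.comp_hasDerivAt σ hline).hasDerivWithinAt
  have hbound : ∀ σ ∈ Ico (0 : ℝ) 1, ‖fderiv ℝ F (p + σ • s • d) (s • d)‖ ≤ s * ε := fun σ hσ => by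
    rw [map_smul, norm_smul, Real.norm_of_nonneg hs]
    exact mul_le_mul_of_nonneg_left (hd _ (hseg σ (Ico_subset_Icc_self hσ))) hs
  simpa using norm_image_sub_le_of_norm_deriv_le_segment_01' hderiv hbound

/-- The Markov operator of the random map `u ↦ F (u, ζ)`, where `ζ` is distributed according to
`μ`. -/
noncomputable def markovOp {H E G : Type*} [MeasurableSpace E] (μ : Measure E) (F : H × E → G)
    (f : G → ℝ) : H → ℝ := fun u => ∫ ζ, f (F (u, ζ)) ∂μ

section LipschitzWeights

variable {E : Type*} {ψ : E → ℝ≥0}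

lemma lipschitzWith_one_sub [PseudoMetricSpace E] {Λ : ℝ≥0} (hψ : LipschitzWith Λ ψ)
    (hψ1 : ∀ x, ψ x ≤ 1) : LipschitzWith Λ fun x => 1 - ψ x := .of_dist_le_mul fun x y => by
  rw [NNReal.dist_eq, NNReal.coe_sub (hψ1 x), NNReal.coe_sub (hψ1 y), sub_sub_sub_cancel_left,
    abs_sub_comm, ← NNReal.dist_eq]
  exact hψ.dist_le_mul x y

lemma withDensity_add_withDensity_one_sub [MeasurableSpace E] {μ : Measure E} (hψ : Measurable ψ)
    (hψ1 : ∀ x, ψ x ≤ 1) :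
    μ.withDensity (fun x => ψ x) + μ.withDensity (fun x => ((1 - ψ x : ℝ≥0) : ℝ≥0∞)) = μ := by
  have hsum : (fun x => (ψ x : ℝ≥0∞)) + (fun x => ((1 - ψ x : ℝ≥0) : ℝ≥0∞)) = 1 := by
    ext x
    rw [Pi.add_apply, ← ENNReal.coe_add, add_tsub_cancel_of_le (hψ1 x)]
    rfl
  rw [← withDensity_add_left hψ.coe_nnreal_ennreal, hsum, withDensity_one]

end LipschitzWeights

section GradientBound

variable {H E G : Type*} [NormedAddCommGroup H] [NormedAddCommGroup E] [MeasurableSpace E]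
  [NormedAddCommGroup G]

/-- The Markov operator of `F` and `μ` improves regularity: up to an additive term `C * ‖g‖`, it
multiplies the Lipschitz constant of an observable `g` by `ε` times the mass of `μ`. The estimate is
local, for pairs of points at distance at most `δ`, one of them in `X`. -/
def GradientBound (μ : Measure E) (F : H × E → G) (X : Set H) (ε : ℝ) (C : ℝ≥0) (δ : ℝ) : Prop :=
  ∀ u ∈ X, ∀ u', ‖u' - u‖ ≤ δ → ∀ (g : G →ᵇ ℝ) (L : ℝ≥0), LipschitzWith L g →
    |markovOp μ F g u - markovOp μ F g u'| ≤ (C * ‖g‖ + L * ε * μ.real univ) * ‖u' - u‖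

variable {μ : Measure E} [IsFiniteMeasure μ] {F : H × E → G} {X : Set H} {ε δ : ℝ} {C : ℝ≥0}

lemma GradientBound.add_measure [BorelSpace E] (hF : Continuous F) {ν : Measure E}
    [IsFiniteMeasure ν] {C' : ℝ≥0} {δ' : ℝ} (hμ : GradientBound μ F X ε C δ)
    (hν : GradientBound ν F X ε C' δ') : GradientBound (μ + ν) F X ε (C + C') (min δ δ') := by
  intro u hu u' huu g L hg
  have hsplit : ∀ w, markovOp (μ + ν) F g w = markovOp μ F g w + markovOp ν F g w := fun w => by
    set Gw : E →ᵇ ℝ := g.compContinuous ⟨fun ζ => F (w, ζ), by fun_prop⟩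
    exact integral_add_measure (Gw.integrable μ) (Gw.integrable ν)
  calc |markovOp (μ + ν) F g u - markovOp (μ + ν) F g u'|
      ≤ |markovOp μ F g u - markovOp μ F g u'| + |markovOp ν F g u - markovOp ν F g u'| := by
        rw [hsplit, hsplit, add_sub_add_comm]
        exact abs_add_le _ _
    _ ≤ (C * ‖g‖ + L * ε * μ.real univ) * ‖u' - u‖
        + (C' * ‖g‖ + L * ε * ν.real univ) * ‖u' - u‖ :=
      add_le_add (hμ u hu u' (huu.trans (min_le_left _ _)) g L hg)
        (hν u hu u' (huu.trans (min_le_right _ _)) g L hg)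
    _ = (↑(C + C') * ‖g‖ + L * ε * (μ + ν).real univ) * ‖u' - u‖ := by
      rw [measureReal_add_apply, NNReal.coe_add]
      ring

variable [NormedSpace ℝ E] [BorelSpace E] {T : Finset E}

/-- The state is moved from `u` to `u'` and, simultaneously, the noise in the direction `h` that
compensates this: the former costs `L * ε`, the latter is absorbed by the regularity of `μ`. -/
lemma abs_markovOp_sub_le_of_control (hF : Continuous F) {h : E}
    (hμ : TranslationLipschitzWith C μ h) {u u' : H} {s : ℝ} (hs : 0 ≤ s)
    (hclose : ∀ᵐ ζ ∂μ, ‖F (u', ζ + s • h) - F (u, ζ)‖ ≤ s * ε) {g : G →ᵇ ℝ} {L : ℝ≥0}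
    (hg : LipschitzWith L g) :
    |markovOp μ F g u - markovOp μ F g u'| ≤ (C * ‖g‖ + L * ε * μ.real univ) * s := by
  set gF : H → E →ᵇ ℝ := fun w => g.compContinuous ⟨fun ζ => F (w, ζ), by fun_prop⟩
  set gF' : E →ᵇ ℝ := (gF u').compContinuous ⟨fun ζ => ζ + s • h, by fun_prop⟩
  have hstate : ‖∫ ζ, (gF u ζ - gF' ζ) ∂μ‖ ≤ L * (s * ε) * μ.real univ := by
    refine norm_integral_le_of_norm_le_const (hclose.mono fun ζ hζ => ?_)
    calc ‖gF u ζ - gF' ζ‖ ≤ L * dist (F (u, ζ)) (F (u', ζ + s • h)) := hg.dist_le_mul _ _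
      _ ≤ L * (s * ε) := by
        rw [dist_comm, dist_eq_norm]
        gcongr
  have hnoise : |∫ ζ, gF' ζ ∂μ - ∫ ζ, gF u' ζ ∂μ| ≤ C * |s| * ‖g‖ :=
    (hμ s (gF u')).trans (by gcongr; exact g.norm_compContinuous_le _)
  calc |∫ ζ, gF u ζ ∂μ - ∫ ζ, gF u' ζ ∂μ|
      ≤ |∫ ζ, gF u ζ ∂μ - ∫ ζ, gF' ζ ∂μ| + |∫ ζ, gF' ζ ∂μ - ∫ ζ, gF u' ζ ∂μ| := abs_sub_le _ _ _
    _ ≤ L * (s * ε) * μ.real univ + C * |s| * ‖g‖ := by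
      refine add_le_add ?_ hnoise
      rwa [← integral_sub ((gF u).integrable μ) (gF'.integrable μ)]
    _ = (C * ‖g‖ + L * ε * μ.real univ) * s := by
      rw [abs_of_nonneg hs]
      ring

variable [NormedSpace ℝ H] [NormedSpace ℝ G] {r : ℝ}

lemma exists_gradientBound_of_ae_mem_ball (hF : ContDiff ℝ 1 F)
    (hT : (T : Set E) ⊆ translationLipschitzSubspace μ) (hr : 0 < r) {ζ₀ : E}
    (hctrl : IsControlSet F (X ×ˢ {ζ₀}) T ε r) (hμ : ∀ᵐ ζ ∂μ, ζ ∈ Metric.ball ζ₀ (r / 2)) :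
    ∃ C, ∃ δ > 0, GradientBound μ F X ε C δ := by
  obtain ⟨C, hC⟩ := exists_forall_translationLipschitzWith hT
  obtain ⟨J, hJ0, hJ⟩ := T.finite_toSet.isBounded.exists_pos_norm_le
  refine ⟨C, r / 2 / (1 + J), by positivity, fun u hu u' huu g L hg => ?_⟩
  set s := ‖u' - u‖ with hs
  obtain ⟨v, hv, hsv⟩ : ∃ v : H, ‖v‖ ≤ 1 ∧ u' - u = s • v := by
    refine ⟨s⁻¹ • (u' - u), ?_, ?_⟩
    · rw [norm_smul, norm_inv, norm_norm, ← hs]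
      exact inv_mul_le_one
    · rcases eq_or_ne s 0 with h0 | h0
      · rw [h0, zero_smul]
        exact norm_eq_zero.1 h0
      · rw [smul_inv_smul₀ h0]
  obtain ⟨h, hh, hhv⟩ := hctrl (u, ζ₀) ⟨hu, rfl⟩ v hv
  refine abs_markovOp_sub_le_of_control hF.continuous (hC h hh) (norm_nonneg _) ?_ hg
  filter_upwards [hμ] with ζ hζ
  have hmove : ((u', ζ + s • h) : H × E) = (u, ζ) + s • (v, h) := by
    rw [Prod.smul_mk, Prod.mk_add_mk, ← hsv, add_sub_cancel]
  have hmem : dist (u, ζ) (u, ζ₀) < r / 2 := by simpa [Prod.dist_eq, hr] using hζ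
  have hstep : ‖s • (v, h)‖ ≤ r / 2 := by
    have hvh : ‖(v, h)‖ ≤ 1 + J := max_le (by linarith) (by linarith [hJ h hh])
    rw [norm_smul, hs, norm_norm]
    exact (mul_le_mul huu hvh (norm_nonneg _) (by positivity)).trans_eq
      (div_mul_cancel₀ _ (by positivity))
  rw [hmove]
  refine norm_map_add_smul_sub_le (convex_ball (u, ζ₀) r)
    (fun q _ => hF.differentiable one_ne_zero q) hhv ?_ (norm_nonneg _) ?_
  · exact Metric.mem_ball.2 (by linarith)
  · rw [Metric.mem_ball]
    have := dist_triangle ((u, ζ) + s • (v, h)) (u, ζ) (u, ζ₀)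
    rw [dist_self_add_left] at this
    linarith

/-- The noise is localised near one centre at a time by Lipschitz weights, which preserve the
regularity of the law. -/
lemma exists_gradientBound_of_ae_mem_biUnion (hF : ContDiff ℝ 1 F)
    (hT : (T : Set E) ⊆ translationLipschitzSubspace μ) (hr : 0 < r) (A : Finset E)
    (hctrl : IsControlSet F (X ×ˢ (A : Set E)) T ε r)
    (hμ : ∀ᵐ ζ ∂μ, ζ ∈ ⋃ a ∈ A, Metric.ball a (r / 4)) :
    ∃ C, ∃ δ > 0, GradientBound μ F X ε C δ := by
  classical
  induction A using Finset.induction_on generalizing μ with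
  | empty =>
    have hμ0 : μ = 0 := by simpa using hμ
    exact ⟨0, 1, one_pos, fun u _ u' _ g L _ => by simp [hμ0, markovOp]⟩
  | insert a A _ ih =>
    have hr4 : 0 < r / 4 := by positivity
    set ψ : E →ᵇ ℝ≥0 := thickenedIndicator hr4 (Metric.ball a (r / 4))
    have hψ1 : ∀ x, ψ x ≤ 1 := thickenedIndicator_le_one hr4 _
    have hψ : LipschitzWith (r / 4).toNNReal⁻¹ ψ := lipschitzWith_thickenedIndicator hr4 _
    have hφ := lipschitzWith_one_sub hψ hψ1
    set μψ := μ.withDensity fun x => ψ x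
    set μφ := μ.withDensity fun x => ((1 - ψ x : ℝ≥0) : ℝ≥0∞)
    have hsum : μψ + μφ = μ := withDensity_add_withDensity_one_sub hψ.continuous.measurable hψ1
    have : IsFiniteMeasure μψ := isFiniteMeasure_of_le μ (hsum ▸ Measure.le_add_right le_rfl)
    have : IsFiniteMeasure μφ := isFiniteMeasure_of_le μ (hsum ▸ Measure.le_add_left le_rfl)
    have hμψ : ∀ᵐ ζ ∂μψ, ζ ∈ Metric.ball a (r / 2) := by
      refine (ae_withDensity_iff hψ.continuous.measurable.coe_nnreal_ennreal).2
        (ae_of_all _ fun ζ hζ => ?_)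
      have hmem : ζ ∈ Metric.thickening (r / 4) (Metric.ball a (r / 4)) := by
        by_contra hnot
        exact hζ (ENNReal.coe_eq_zero.2 (thickenedIndicator_zero hr4 _ hnot))
      exact Metric.ball_subset_ball (by linarith) (Metric.thickening_ball _ _ _ hmem)
    have hμφ : ∀ᵐ ζ ∂μφ, ζ ∈ ⋃ a ∈ A, Metric.ball a (r / 4) := by
      refine (ae_withDensity_iff hφ.continuous.measurable.coe_nnreal_ennreal).2 ?_
      filter_upwards [hμ] with ζ hζ hne
      rw [Finset.set_biUnion_insert] at hζ
      refine hζ.resolve_left fun hmem => hne ?_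
      rw [thickenedIndicator_one hr4 _ hmem, tsub_self, ENNReal.coe_zero]
    obtain ⟨C, δ, hδ, hC⟩ := exists_gradientBound_of_ae_mem_ball (μ := μψ) hF
      (hT.trans (translationLipschitzSubspace_le_withDensity hψ hψ1)) hr
      (hctrl.mono (prod_mono_right (by simp)) subset_rfl le_rfl) hμψ
    obtain ⟨C', δ', hδ', hC'⟩ := ih (μ := μφ)
      (hT.trans (translationLipschitzSubspace_le_withDensity hφ fun _ => tsub_le_self))
      (hctrl.mono (prod_mono_right (by simp)) subset_rfl le_rfl) hμφ
    exact ⟨_, _, lt_min hδ hδ', hsum ▸ hC.add_measure hF.continuous hC'⟩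

theorem exists_gradientBound (hF : ContDiff ℝ 1 F) (hX : IsCompact X) {K : Set E} (hK : IsCompact K)
    (hμK : ∀ᵐ ζ ∂μ, ζ ∈ K) (hμ : Dense (translationLipschitzSubspace μ : Set E))
    (hcomp : ∀ p ∈ X ×ˢ K, IsCompactOperator fun v : H => fderiv ℝ F p (v, 0))
    (hdense : ∀ p ∈ X ×ˢ K, DenseRange fun h : E => fderiv ℝ F p (0, h)) (hε : 0 < ε) :
    ∃ C, ∃ δ > 0, GradientBound μ F X ε C δ := by
  obtain ⟨T, hT, r, hr, hctrl⟩ := exists_isControlSet hF (hX.prod hK) hcomp hdense hμ hε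
  obtain ⟨A, hAK, hAfin, hcover⟩ := hK.finite_cover_balls (show 0 < r / 4 by positivity)
  lift A to Finset E using hAfin
  exact exists_gradientBound_of_ae_mem_biUnion hF hT hr A
    (hctrl.mono (prod_mono_right hAK) subset_rfl le_rfl) (hμK.mono fun ζ hζ => hcover hζ)

end GradientBound

section MarkovOp

variable {H E G : Type*} [MeasurableSpace H] [MeasurableSpace E] [MeasurableSpace G]
  {ℓ : Measure E} [IsProbabilityMeasure ℓ] {F : H × E → G} {f : G → ℝ}

lemma abs_markovOp_le_one {H E G : Type*} [MeasurableSpace E] {ℓ : Measure E}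
    [IsProbabilityMeasure ℓ] {F : H × E → G} {f : G → ℝ} (hf1 : ∀ x, |f x| ≤ 1) (u : H) :
    |markovOp ℓ F f u| ≤ 1 := by
  simpa [markovOp] using norm_integral_le_of_norm_le_const (μ := ℓ) (f := fun ζ => f (F (u, ζ)))
    (ae_of_all _ fun ζ => hf1 _)

lemma measurable_markovOp (hF : Measurable F) (hf : Measurable f) : Measurable (markovOp ℓ F f) :=
  (StronglyMeasurable.integral_prod_right (f := fun u ζ => f (F (u, ζ)))
    (hf.comp hF).stronglyMeasurable).measurable

lemma abs_markovOp_sub_le_integral (hF : Measurable F) (hf : Measurable f) (hf1 : ∀ x, |f x| ≤ 1)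
    {b : E → ℝ} (hb : Integrable b ℓ) {u u' : H}
    (hfb : ∀ᵐ ζ ∂ℓ, |f (F (u, ζ)) - f (F (u', ζ))| ≤ b ζ) :
    |markovOp ℓ F f u - markovOp ℓ F f u'| ≤ ∫ ζ, b ζ ∂ℓ := by
  have hint : ∀ w, Integrable (fun ζ => f (F (w, ζ))) ℓ := fun w =>
    .of_bound (hf.comp (hF.comp measurable_prodMk_left)).aestronglyMeasurable 1
      (ae_of_all _ fun ζ => hf1 _)
  rw [markovOp, markovOp, ← integral_sub (hint u) (hint u')]
  exact norm_integral_le_of_norm_le (f := fun ζ => f (F (u, ζ)) - f (F (u', ζ))) hb hfb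

lemma abs_markovOp_sub_le (hF : Measurable F) (hf : Measurable f) (hf1 : ∀ x, |f x| ≤ 1)
    {B : ℝ} {u u' : H} (hfB : ∀ᵐ ζ ∂ℓ, |f (F (u, ζ)) - f (F (u', ζ))| ≤ B) :
    |markovOp ℓ F f u - markovOp ℓ F f u'| ≤ B := by
  simpa using abs_markovOp_sub_le_integral hF hf hf1 (integrable_const B) hfB

end MarkovOp

section Contraction

variable {H E : Type*} [NormedAddCommGroup H] [MeasurableSpace H]

/-- Measurable observables bounded by `1` that are `c`-Lipschitz on `X` for the truncated metric
`min 1 (‖x - y‖ / δ)`. -/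
structure Observable (X : Set H) (δ : ℝ) (c : ℝ≥0) (f : H → ℝ) : Prop where
  measurable : Measurable f
  abs_le_one : ∀ x, |f x| ≤ 1
  abs_sub_le : ∀ x ∈ X, ∀ y ∈ X, |f x - f y| ≤ c * min 1 (‖x - y‖ / δ)

variable {X : Set H} {δ : ℝ} {c : ℝ≥0} {f : H → ℝ}

namespace Observable

lemma abs_sub_le_const (hf : Observable X δ c f) {x y : H} (hx : x ∈ X) (hy : y ∈ X) :
    |f x - f y| ≤ c :=
  (hf.abs_sub_le x hx y hy).trans (mul_le_of_le_one_right c.2 (min_le_left _ _))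

lemma abs_sub_le_mul_div (hf : Observable X δ c f) {x y : H} (hx : x ∈ X) (hy : y ∈ X) :
    |f x - f y| ≤ c * (‖x - y‖ / δ) :=
  (hf.abs_sub_le x hx y hy).trans (mul_le_mul_of_nonneg_left (min_le_right _ _) c.2)

lemma of_forall_abs_sub_le (hm : Measurable f) (hf1 : ∀ x, |f x| ≤ 1) (hδ : 0 < δ)
    (hnear : ∀ x ∈ X, ∀ y ∈ X, ‖x - y‖ ≤ δ → |f x - f y| ≤ c * (‖x - y‖ / δ))
    (hfar : ∀ x ∈ X, ∀ y ∈ X, |f x - f y| ≤ c) : Observable X δ c f where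
  measurable := hm
  abs_le_one := hf1
  abs_sub_le x hx y hy := by
    rcases le_total ‖x - y‖ δ with h | h
    · rw [min_eq_right ((div_le_one hδ).2 h)]
      exact hnear x hx y hy h
    · rw [min_eq_left ((one_le_div hδ).2 h), mul_one]
      exact hfar x hx y hy

lemma of_lipschitzWith [OpensMeasurableSpace H] (hf : LipschitzWith 1 f) (hf1 : ∀ x, |f x| ≤ 1)
    (hδ : 0 < δ) (hδ2 : δ ≤ 2) : Observable X δ 2 f := by
  refine of_forall_abs_sub_le hf.continuous.measurable hf1 hδ (fun x _ y _ _ => ?_)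
    fun x _ y _ => ?_
  · calc |f x - f y| ≤ ‖x - y‖ := by
          simpa [Real.dist_eq, dist_eq_norm] using hf.dist_le_mul x y
      _ ≤ 2 / δ * ‖x - y‖ := le_mul_of_one_le_left (norm_nonneg _) ((one_le_div hδ).2 hδ2)
      _ = (2 : ℝ≥0) * (‖x - y‖ / δ) := by
        rw [NNReal.coe_ofNat]
        ring
  · exact (abs_sub _ _).trans ((add_le_add (hf1 x) (hf1 y)).trans_eq one_add_one_eq_two)

lemma exists_lipschitz_extension (hf : Observable X δ c f) (hδ : 0 < δ) {u : H} (hu : u ∈ X) :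
    ∃ g : H →ᵇ ℝ, LipschitzWith (c / δ).toNNReal g ∧ ‖g‖ ≤ c ∧ ∀ x ∈ X, f x = g x + f u := by
  have hlip : LipschitzOnWith (c / δ).toNNReal (fun x => f x - f u) X := by
    refine .of_dist_le_mul fun x hx y hy => ?_
    rw [Real.coe_toNNReal _ (by positivity), Real.dist_eq, dist_eq_norm, sub_sub_sub_cancel_right]
    exact (hf.abs_sub_le_mul_div hx hy).trans_eq (mul_comm_div ..).symm
  obtain ⟨g, hg, hgX⟩ := hlip.extend_real
  have htrunc : LipschitzWith (c / δ).toNNReal fun x => max (-(c : ℝ)) (min c (g x)) :=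
    (hg.const_min _).const_max _
  refine ⟨.ofNormedAddCommGroup _ htrunc.continuous c fun x => ?_, htrunc,
    BoundedContinuousFunction.norm_ofNormedAddCommGroup_le _ c.2 _, fun x hx => ?_⟩
  · exact abs_le.2 ⟨le_max_left _ _, max_le (neg_le_self c.2) (min_le_left _ _)⟩
  · have hgx : f x - f u = g x := hgX hx
    obtain ⟨hlow, hhigh⟩ := abs_le.1 (hgx ▸ hf.abs_sub_le_const hx hu)
    simp only [BoundedContinuousFunction.coe_ofNormedAddCommGroup]
    rw [min_eq_right hhigh, max_eq_right hlow, ← hgx, sub_add_cancel]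

end Observable

variable [MeasurableSpace E] {ℓ : Measure E} {F : H × E → H}

/-- On pairs of points of `X` at distance at most `δ`, the Markov operator halves the Lipschitz
constants of observables. -/
def LocallyContracting (ℓ : Measure E) (F : H × E → H) (X : Set H) (δ : ℝ) : Prop :=
  ∀ (c : ℝ≥0) (f : H → ℝ), Observable X δ c f → ∀ u ∈ X, ∀ u' ∈ X, ‖u - u'‖ ≤ δ →
    |markovOp ℓ F f u - markovOp ℓ F f u'| ≤ c / 2 * (‖u - u'‖ / δ)

variable [IsProbabilityMeasure ℓ]

lemma GradientBound.locallyContracting [NormedAddCommGroup E] [BorelSpace E] [BorelSpace H]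
    (hF : Continuous F) (hinv : ∀ u ∈ X, ∀ᵐ ζ ∂ℓ, F (u, ζ) ∈ X) {ε δ₀ : ℝ} {C : ℝ≥0}
    (h : GradientBound ℓ F X ε C δ₀) (hδ : 0 < δ) (hδ₀ : δ ≤ δ₀) (hCδ : C * δ + ε ≤ 1 / 2) :
    LocallyContracting ℓ F X δ := by
  intro c f hf u hu u' hu' huu
  obtain ⟨g, hg, hgc, hfg⟩ := hf.exists_lipschitz_extension hδ hu
  have hshift : ∀ w ∈ X, markovOp ℓ F f w = markovOp ℓ F g w + f u := fun w hw => by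
    set gF : E →ᵇ ℝ := g.compContinuous ⟨fun ζ => F (w, ζ), by fun_prop⟩
    calc ∫ ζ, f (F (w, ζ)) ∂ℓ = ∫ ζ, (gF ζ + f u) ∂ℓ :=
          integral_congr_ae ((hinv w hw).mono fun ζ hζ => hfg _ hζ)
      _ = ∫ ζ, gF ζ ∂ℓ + f u := by
        rw [integral_add (gF.integrable ℓ) (integrable_const _), integral_const, probReal_univ,
          one_smul]
  calc |markovOp ℓ F f u - markovOp ℓ F f u'|
      = |markovOp ℓ F g u - markovOp ℓ F g u'| := by
        rw [hshift u hu, hshift u' hu', add_sub_add_right_eq_sub]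
    _ ≤ (C * ‖g‖ + c / δ * ε) * ‖u - u'‖ := by
      rw [norm_sub_rev] at huu ⊢
      simpa [Real.coe_toNNReal _ (show 0 ≤ c / δ by positivity)] using
        h u hu u' (huu.trans hδ₀) g _ hg
    _ ≤ (C * c + c / δ * ε) * ‖u - u'‖ := by gcongr
    _ = c * (C * δ + ε) * (‖u - u'‖ / δ) := by
      field_simp
    _ ≤ c * (1 / 2) * (‖u - u'‖ / δ) := by gcongr
    _ = c / 2 * (‖u - u'‖ / δ) := by ring

namespace LocallyContracting

lemma observable_markovOp (h : LocallyContracting ℓ F X δ) (hδ : 0 < δ) (hF : Measurable F)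
    (hinv : ∀ u ∈ X, ∀ᵐ ζ ∂ℓ, F (u, ζ) ∈ X) (hf : Observable X δ c f) :
    Observable X δ c (markovOp ℓ F f) := by
  refine .of_forall_abs_sub_le (measurable_markovOp hF hf.measurable)
    (abs_markovOp_le_one hf.abs_le_one) hδ (fun u hu u' hu' huu => ?_) fun u hu u' hu' => ?_
  · exact (h c f hf u hu u' hu' huu).trans (by gcongr; exact half_le_self c.2)
  · refine abs_markovOp_sub_le hF hf.measurable hf.abs_le_one ?_
    filter_upwards [hinv u hu, hinv u' hu'] with ζ hζ hζ' using hf.abs_sub_le_const hζ hζ'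

lemma observable_iterate_markovOp (h : LocallyContracting ℓ F X δ) (hδ : 0 < δ) (hF : Measurable F)
    (hinv : ∀ u ∈ X, ∀ᵐ ζ ∂ℓ, F (u, ζ) ∈ X) (hf : Observable X δ c f) (k : ℕ) :
    Observable X δ c ((markovOp ℓ F)^[k] f) := by
  induction k with
  | zero => exact hf
  | succ k ih =>
    rw [Function.iterate_succ_apply']
    exact h.observable_markovOp hδ hF hinv ih

end LocallyContracting

/-- The Markov semigroup contracts the Lipschitz-dual distance between Dirac masses at points of `X`
exponentially fast, at rate `κ` and with constant `C`. -/
def ExponentiallyContracting (ℓ : Measure E) (F : H × E → H) (X : Set H) (κ C : ℝ) : Prop :=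
  ∀ f : H → ℝ, (∀ x, |f x| ≤ 1) → LipschitzWith 1 f → ∀ u ∈ X, ∀ u' ∈ X, ∀ k : ℕ,
    |(markovOp ℓ F)^[k] f u - (markovOp ℓ F)^[k] f u'| ≤ C * ‖u - u'‖ * κ ^ k

lemma ExponentiallyContracting.of_mapsTo [BorelSpace H] {κ C Λ : ℝ} {B : Set H}
    (h : ExponentiallyContracting ℓ F X κ C) (hκ : 0 < κ) (hC : 0 ≤ C) (hF : Measurable F)
    (hBX : ∀ u ∈ B, ∀ᵐ ζ ∂ℓ, F (u, ζ) ∈ X)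
    (hlip : ∀ u ∈ B, ∀ u' ∈ B, ∀ᵐ ζ ∂ℓ, ‖F (u, ζ) - F (u', ζ)‖ ≤ Λ * ‖u - u'‖) :
    ExponentiallyContracting ℓ F B κ (max 1 (C * Λ / κ)) := by
  intro f hf1 hf u hu u' hu' k
  cases k with
  | zero =>
    have hfu : |f u - f u'| ≤ ‖u - u'‖ := by
      simpa [Real.dist_eq, dist_eq_norm] using hf.dist_le_mul u u'
    rw [pow_zero, mul_one]
    exact hfu.trans (le_mul_of_one_le_left (norm_nonneg _) (le_max_left _ _))
  | succ k =>
    obtain ⟨hgm, hg1⟩ : Measurable ((markovOp ℓ F)^[k] f) ∧ ∀ x, |(markovOp ℓ F)^[k] f x| ≤ 1 :=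
      Function.Iterate.rec (fun g : H → ℝ => Measurable g ∧ ∀ x, |g x| ≤ 1)
        ⟨hf.continuous.measurable, hf1⟩
        (fun g hg => ⟨measurable_markovOp hF hg.1, abs_markovOp_le_one hg.2⟩) k
    rw [Function.iterate_succ_apply']
    refine abs_markovOp_sub_le hF hgm hg1 ?_
    filter_upwards [hBX u hu, hBX u' hu', hlip u hu u' hu'] with ζ hζ hζ' hle
    calc |(markovOp ℓ F)^[k] f (F (u, ζ)) - (markovOp ℓ F)^[k] f (F (u', ζ))|
        ≤ C * ‖F (u, ζ) - F (u', ζ)‖ * κ ^ k := h f hf1 hf _ hζ _ hζ' k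
      _ ≤ C * (Λ * ‖u - u'‖) * κ ^ k := by gcongr
      _ = C * Λ / κ * ‖u - u'‖ * κ ^ (k + 1) := by
        rw [pow_succ]
        field_simp
      _ ≤ max 1 (C * Λ / κ) * ‖u - u'‖ * κ ^ (k + 1) := by
        gcongr
        exact le_max_right _ _

variable [NormedAddCommGroup E] [OpensMeasurableSpace E] {γ Λ θ : ℝ}

/-- Two trajectories are driven by the same noise. When it is small, both are pushed into the ball
of radius `s`, where the observable oscillates less. -/
lemma abs_markovOp_sub_le_of_ball (hF : Measurable F) (hinv : ∀ u ∈ X, ∀ᵐ ζ ∂ℓ, F (u, ζ) ∈ X)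
    (hγ : 0 ≤ γ) (hΛ : 0 ≤ Λ) (hdis : ∀ u ∈ X, ∀ᵐ ζ ∂ℓ, ‖F (u, ζ)‖ ≤ γ * ‖u‖ + Λ * ‖ζ‖)
    {s s' a : ℝ} (hs : γ * s' + Λ * θ ≤ s) (hf : Observable X δ c f)
    (hfs : ∀ x ∈ X, ∀ y ∈ X, ‖x‖ ≤ s → ‖y‖ ≤ s → |f x - f y| ≤ c * (1 - a))
    {u u' : H} (hu : u ∈ X) (hu' : u' ∈ X) (hus : ‖u‖ ≤ s') (hus' : ‖u'‖ ≤ s') :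
    |markovOp ℓ F f u - markovOp ℓ F f u'| ≤ c * (1 - a * ℓ.real (Metric.ball 0 θ)) := by
  set B := Metric.ball (0 : E) θ
  have hB : MeasurableSet B := Metric.isOpen_ball.measurableSet
  have hBint : Integrable (fun ζ => a * B.indicator 1 ζ) ℓ :=
    ((integrable_const (1 : ℝ)).indicator hB).const_mul a
  have hsmall : ∀ {w : H} {ζ : E}, ‖w‖ ≤ s' → ζ ∈ B → ‖F (w, ζ)‖ ≤ γ * ‖w‖ + Λ * ‖ζ‖ →
      ‖F (w, ζ)‖ ≤ s := fun {w ζ} hw hζ hF => by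
    have := (mem_ball_zero_iff.1 hζ).le
    exact hF.trans (le_trans (by gcongr) hs)
  have hbound : ∀ᵐ ζ ∂ℓ, |f (F (u, ζ)) - f (F (u', ζ))| ≤ c * (1 - a * B.indicator 1 ζ) := by
    filter_upwards [hinv u hu, hinv u' hu', hdis u hu, hdis u' hu'] with ζ hX hX' hd hd'
    by_cases hζ : ζ ∈ B
    · rw [indicator_of_mem hζ, Pi.one_apply, mul_one]
      exact hfs _ hX _ hX' (hsmall hus hζ hd) (hsmall hus' hζ hd')
    · rw [indicator_of_notMem hζ, mul_zero, sub_zero, mul_one]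
      exact hf.abs_sub_le_const hX hX'
  have hint : Integrable (fun ζ => 1 - a * B.indicator 1 ζ) ℓ := (integrable_const 1).sub hBint
  refine (abs_markovOp_sub_le_integral hF hf.measurable hf.abs_le_one (hint.const_mul c)
    hbound).trans_eq ?_
  rw [integral_const_mul, integral_sub (integrable_const 1) hBint, integral_const_mul,
    integral_indicator_one hB, integral_const, probReal_univ, one_smul]

namespace LocallyContracting

/-- The radii solve `γ * s (m + 1) + (1 - γ) * (δ / 8) = s m`, and `s 0 = δ / 4`. -/
lemma abs_iterate_markovOp_sub_le_of_ball (h : LocallyContracting ℓ F X δ) (hδ : 0 < δ)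
    (hF : Measurable F) (hinv : ∀ u ∈ X, ∀ᵐ ζ ∂ℓ, F (u, ζ) ∈ X) (hγ : 0 < γ) (hΛ : 0 ≤ Λ)
    (hdis : ∀ u ∈ X, ∀ᵐ ζ ∂ℓ, ‖F (u, ζ)‖ ≤ γ * ‖u‖ + Λ * ‖ζ‖)
    (hθ : Λ * θ ≤ (1 - γ) * (δ / 8)) (hf : Observable X δ c f) (m : ℕ) :
    ∀ x ∈ X, ∀ y ∈ X, ‖x‖ ≤ δ / 8 * γ⁻¹ ^ m + δ / 8 → ‖y‖ ≤ δ / 8 * γ⁻¹ ^ m + δ / 8 →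
      |(markovOp ℓ F)^[m] f x - (markovOp ℓ F)^[m] f y| ≤
        c * (1 - 1 / 2 * ℓ.real (Metric.ball 0 θ) ^ m) := by
  induction m with
  | zero =>
    intro x hx y hy hxs hys
    rw [pow_zero, mul_one] at hxs hys
    calc |f x - f y| ≤ c * (‖x - y‖ / δ) := hf.abs_sub_le_mul_div hx hy
      _ ≤ c * (1 - 1 / 2 * ℓ.real (Metric.ball 0 θ) ^ 0) := by
        gcongr
        rw [div_le_iff₀ hδ, pow_zero]
        linarith [norm_sub_le x y]
  | succ m ih =>
    intro x hx y hy hxs hys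
    rw [Function.iterate_succ_apply', pow_succ _ m, ← mul_assoc]
    refine abs_markovOp_sub_le_of_ball hF hinv hγ.le hΛ hdis ?_
      (h.observable_iterate_markovOp hδ hF hinv hf m) ih hx hy hxs hys
    calc γ * (δ / 8 * γ⁻¹ ^ (m + 1) + δ / 8) + Λ * θ
        ≤ γ * (δ / 8 * γ⁻¹ ^ (m + 1) + δ / 8) + (1 - γ) * (δ / 8) := by gcongr
      _ = δ / 8 * γ⁻¹ ^ m + δ / 8 := by
        rw [pow_succ]
        field_simp
        ring

lemma exists_observable_contraction (h : LocallyContracting ℓ F X δ) (hδ : 0 < δ)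
    (hF : Measurable F) (hinv : ∀ u ∈ X, ∀ᵐ ζ ∂ℓ, F (u, ζ) ∈ X) (hγ : 0 < γ) (hγ1 : γ < 1)
    (hΛ : 0 ≤ Λ) (hdis : ∀ u ∈ X, ∀ᵐ ζ ∂ℓ, ‖F (u, ζ)‖ ≤ γ * ‖u‖ + Λ * ‖ζ‖)
    (hX : Bornology.IsBounded X) (h0 : 0 ∈ ℓ.support) :
    ∃ n ≠ 0, ∃ κ : ℝ≥0, 0 < κ ∧ κ < 1 ∧ ∀ (c : ℝ≥0) (f : H → ℝ),
      Observable X δ c f → Observable X δ (κ * c) ((markovOp ℓ F)^[n] f) := by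
  obtain ⟨θ, hθ0, hθ⟩ : ∃ θ > 0, Λ * θ < (1 - γ) * (δ / 8) :=
    exists_pos_mul_lt (mul_pos (sub_pos.2 hγ1) (by positivity)) Λ
  set p := ℓ.real (Metric.ball (0 : E) θ)
  have hp0 : 0 < p :=
    have := (Measure.mem_support_iff_forall _).1 h0 _ (Metric.ball_mem_nhds 0 hθ0)
    ENNReal.toReal_pos this.ne' (measure_ne_top _ _)
  obtain ⟨R, hR⟩ := hX.exists_norm_le
  obtain ⟨m, hm⟩ := pow_unbounded_of_one_lt (R / (δ / 8)) ((one_lt_inv₀ hγ).2 hγ1)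
  have hRm : R ≤ δ / 8 * γ⁻¹ ^ (m + 1) + δ / 8 := by
    have hpow : γ⁻¹ ^ m ≤ γ⁻¹ ^ (m + 1) :=
      pow_le_pow_right₀ ((one_lt_inv₀ hγ).2 hγ1).le (Nat.le_succ m)
    have := (div_le_iff₀' (by positivity)).1 (hm.le.trans hpow)
    linarith
  have hpm : p ^ (m + 1) ≤ 1 := pow_le_one₀ hp0.le measureReal_le_one
  have hpm0 : 0 < p ^ (m + 1) := by positivity
  set κ : ℝ≥0 := ⟨1 - 1 / 2 * p ^ (m + 1), by linarith⟩
  have hκ : (κ : ℝ) = 1 - 1 / 2 * p ^ (m + 1) := rfl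
  refine ⟨m + 1, m.succ_ne_zero, κ, NNReal.coe_pos.1 (by linarith),
    NNReal.coe_lt_one.1 (by linarith), fun c f hf => ?_⟩
  have hobs := h.observable_iterate_markovOp hδ hF hinv hf
  refine .of_forall_abs_sub_le (hobs _).measurable (hobs _).abs_le_one hδ
    (fun u hu u' hu' huu => ?_) fun u hu u' hu' => ?_
  · rw [Function.iterate_succ_apply']
    refine (h c _ (hobs m) u hu u' hu' huu).trans ?_
    rw [NNReal.coe_mul, div_eq_inv_mul]
    gcongr
    linarith
  · rw [NNReal.coe_mul, mul_comm]
    exact h.abs_iterate_markovOp_sub_le_of_ball hδ hF hinv hγ hΛ hdis hθ.le hf (m + 1) u hu u' hu'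
      ((hR u hu).trans hRm) ((hR u' hu').trans hRm)

end LocallyContracting

lemma exists_pow_div_le {κ : ℝ} (hκ : 0 < κ) (hκ1 : κ < 1) {n : ℕ} (hn : n ≠ 0) :
    ∃ κ' : ℝ, 0 < κ' ∧ κ' < 1 ∧ ∀ k : ℕ, κ ^ (k / n) ≤ κ⁻¹ * κ' ^ k := by
  obtain ⟨κ', hκ', rfl⟩ : ∃ κ' : ℝ, 0 < κ' ∧ κ' ^ n = κ :=
    ⟨κ ^ (n⁻¹ : ℝ), Real.rpow_pos_of_pos hκ _, Real.rpow_inv_natCast_pow hκ.le hn⟩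
  have hκ'1 : κ' < 1 := (pow_lt_one_iff_of_nonneg hκ'.le hn).1 hκ1
  refine ⟨κ', hκ', hκ'1, fun k => (le_inv_mul_iff₀ hκ).2 ?_⟩
  rw [← pow_succ', ← pow_mul]
  exact pow_le_pow_of_le_one hκ'.le hκ'1.le (Nat.lt_mul_div_succ k (Nat.pos_of_ne_zero hn)).le

lemma LocallyContracting.exists_exponentiallyContracting [BorelSpace H]
    (h : LocallyContracting ℓ F X δ) (hδ : 0 < δ) (hδ2 : δ ≤ 2) (hF : Measurable F)
    (hinv : ∀ u ∈ X, ∀ᵐ ζ ∂ℓ, F (u, ζ) ∈ X) (hγ : 0 < γ) (hγ1 : γ < 1) (hΛ : 0 ≤ Λ)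
    (hdis : ∀ u ∈ X, ∀ᵐ ζ ∂ℓ, ‖F (u, ζ)‖ ≤ γ * ‖u‖ + Λ * ‖ζ‖) (hX : Bornology.IsBounded X)
    (h0 : 0 ∈ ℓ.support) :
    ∃ κ C : ℝ, 0 < κ ∧ κ < 1 ∧ 0 < C ∧ ExponentiallyContracting ℓ F X κ C := by
  obtain ⟨n, hn, κ, hκ0, hκ1, hcontr⟩ :=
    h.exists_observable_contraction hδ hF hinv hγ hγ1 hΛ hdis hX h0
  obtain ⟨κ', hκ'0, hκ'1, hκ'⟩ :=
    exists_pow_div_le (NNReal.coe_pos.2 hκ0) (NNReal.coe_lt_one.2 hκ1) hn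
  refine ⟨κ', (κ : ℝ)⁻¹ * (2 / δ), hκ'0, hκ'1, by positivity, fun f hf1 hf u hu u' hu' k => ?_⟩
  have hmul : ∀ m : ℕ, Observable X δ (κ ^ m * 2) ((markovOp ℓ F)^[n * m] f) := fun m => by
    induction m with
    | zero => simpa using Observable.of_lipschitzWith hf hf1 hδ hδ2
    | succ m ih =>
      rw [Nat.mul_succ, Nat.add_comm (n * m) n, Function.iterate_add_apply, pow_succ', mul_assoc]
      exact hcontr _ _ ih
  have hk : Observable X δ (κ ^ (k / n) * 2) ((markovOp ℓ F)^[k] f) := by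
    conv_rhs => rw [← Nat.mod_add_div k n, Function.iterate_add_apply]
    exact h.observable_iterate_markovOp hδ hF hinv (hmul (k / n)) (k % n)
  calc |(markovOp ℓ F)^[k] f u - (markovOp ℓ F)^[k] f u'|
      ≤ κ ^ (k / n) * 2 * (‖u - u'‖ / δ) := by simpa using hk.abs_sub_le_mul_div hu hu'
    _ ≤ (κ : ℝ)⁻¹ * κ' ^ k * 2 * (‖u - u'‖ / δ) := by
      gcongr
      exact hκ' k
    _ = (κ : ℝ)⁻¹ * (2 / δ) * ‖u - u'‖ * κ' ^ k := by ring

end Contraction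

section Dissipative

variable {H E : Type*} [NormedAddCommGroup H] {F : H × E → H} {K : Set E} {γ β : ℝ}

lemma exists_closedBall_mapsTo_of_dissipative (hγ : 0 ≤ γ) (hγ1 : γ < 1)
    (hdis : ∀ u, ∀ ζ ∈ K, ‖F (u, ζ)‖ ≤ γ * ‖u‖ + β) (R : ℝ) :
    ∃ R' ≥ R, MapsTo F (Metric.closedBall 0 R' ×ˢ K) (Metric.closedBall 0 R') := by
  refine ⟨max R (β / (1 - γ)), le_max_left _ _, fun ⟨u, ζ⟩ ⟨hu, hζ⟩ => ?_⟩
  have hβ : β ≤ max R (β / (1 - γ)) * (1 - γ) :=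
    (div_le_iff₀ (sub_pos.2 hγ1)).1 (le_max_right _ _)
  have hγu := mul_le_mul_of_nonneg_left (mem_closedBall_zero_iff.1 hu) hγ
  exact mem_closedBall_zero_iff.2 (by linarith [hdis u ζ hζ])

variable [NormedAddCommGroup E]

lemma exists_isCompact_mapsTo_of_dissipative
    (hcpt : ∀ B, Bornology.IsBounded B → IsCompact (closure (F '' B))) (hK : Bornology.IsBounded K)
    (hγ : 0 ≤ γ) (hγ1 : γ < 1) (hdis : ∀ u, ∀ ζ ∈ K, ‖F (u, ζ)‖ ≤ γ * ‖u‖ + β) (R : ℝ) :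
    ∃ R' ≥ R, ∃ X ⊆ Metric.closedBall 0 R', IsCompact X ∧
      MapsTo F (Metric.closedBall 0 R' ×ˢ K) X := by
  obtain ⟨R', hR', hmaps⟩ := exists_closedBall_mapsTo_of_dissipative hγ hγ1 hdis R
  exact ⟨R', hR', closure (F '' (Metric.closedBall 0 R' ×ˢ K)),
    closure_minimal hmaps.image_subset Metric.isClosed_closedBall,
    hcpt _ (Metric.isBounded_closedBall.prod hK), fun p hp => subset_closure ⟨p, hp, rfl⟩⟩

lemma norm_le_mul_add_mul_of_lipschitzOnWith {s : Set H} {Λ : ℝ≥0}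
    (hlip : LipschitzOnWith Λ F (s ×ˢ K)) (h0 : 0 ∈ K) (hdis : ∀ u, ‖F (u, 0)‖ ≤ γ * ‖u‖) {u : H}
    (hu : u ∈ s) {ζ : E} (hζ : ζ ∈ K) : ‖F (u, ζ)‖ ≤ γ * ‖u‖ + Λ * ‖ζ‖ := by
  have hsub : ‖F (u, ζ) - F (u, 0)‖ ≤ Λ * ‖ζ‖ := by
    simpa using hlip.norm_sub_le (mk_mem_prod hu hζ) (mk_mem_prod hu h0)
  calc ‖F (u, ζ)‖ = ‖F (u, 0) + (F (u, ζ) - F (u, 0))‖ := by rw [add_sub_cancel]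
    _ ≤ γ * ‖u‖ + Λ * ‖ζ‖ := (norm_add_le _ _).trans (add_le_add (hdis u) hsub)

end Dissipative

section Mixing

variable {H E : Type*} [NormedAddCommGroup H] [NormedSpace ℝ H] [MeasurableSpace H] [BorelSpace H]
  [NormedAddCommGroup E] [NormedSpace ℝ E] [SecondCountableTopology E] [MeasurableSpace E]
  [BorelSpace E] {ℓ : Measure E} [IsProbabilityMeasure ℓ] {F : H × E → H}

lemma exists_locallyContracting (hF : ContDiff ℝ 1 F) {X : Set H} (hX : IsCompact X)
    (hinv : MapsTo F (X ×ˢ ℓ.support) X) (hK : IsCompact ℓ.support)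
    (hℓ : Dense (translationLipschitzSubspace ℓ : Set E))
    (hcomp : ∀ p, IsCompactOperator fun v => fderiv ℝ F p (v, 0))
    (hdense : ∀ u, ∀ ζ ∈ ℓ.support, DenseRange fun h => fderiv ℝ F (u, ζ) (0, h)) :
    ∃ δ > 0, δ ≤ 2 ∧ LocallyContracting ℓ F X δ := by
  obtain ⟨C, δ₀, hδ₀, hgrad⟩ := exists_gradientBound hF hX hK Measure.support_mem_ae hℓ
    (fun p _ => hcomp p) (fun p hp => hdense p.1 p.2 hp.2) (ε := 1 / 4) (by norm_num)
  obtain ⟨δ₁, hδ₁, hCδ₁⟩ := exists_pos_mul_lt (show (0 : ℝ) < 1 / 4 by norm_num) C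
  refine ⟨min δ₁ (min δ₀ 2), by positivity, (min_le_right _ _).trans (min_le_right _ _), ?_⟩
  refine hgrad.locallyContracting hF.continuous (fun u hu => ?_) (by positivity)
    ((min_le_right _ _).trans (min_le_left _ _)) ?_
  · filter_upwards [Measure.support_mem_ae] with ζ hζ using hinv ⟨hu, hζ⟩
  · have hC : C * min δ₁ (min δ₀ 2) ≤ C * δ₁ := by gcongr; exact min_le_left _ _
    linarith

theorem exists_exponentiallyContracting_closedBall (hF : ContDiff ℝ 1 F)
    (hlip : ∀ B, Bornology.IsBounded B → ∃ Λ, LipschitzOnWith Λ F B)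
    (hcpt : ∀ B, Bornology.IsBounded B → IsCompact (closure (F '' B)))
    (hcomp : ∀ p, IsCompactOperator fun v => fderiv ℝ F p (v, 0)) (hK : IsCompact ℓ.support)
    (hℓ : Dense (translationLipschitzSubspace ℓ : Set E)) (h0 : 0 ∈ ℓ.support)
    (hdense : ∀ u, ∀ ζ ∈ ℓ.support, DenseRange fun h => fderiv ℝ F (u, ζ) (0, h))
    {γ β : ℝ} (hγ : 0 < γ) (hγ1 : γ < 1)
    (hdis : ∀ u, ∀ ζ ∈ ℓ.support, ‖F (u, ζ)‖ ≤ γ * ‖u‖ + β)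
    (hdis0 : ∀ u, ‖F (u, 0)‖ ≤ γ * ‖u‖) (R : ℝ) :
    ∃ κ C : ℝ, 0 < κ ∧ κ < 1 ∧ 0 < C ∧
      ExponentiallyContracting ℓ F (Metric.closedBall 0 R) κ C := by
  obtain ⟨R', hR', X, hXB, hX, hmaps⟩ :=
    exists_isCompact_mapsTo_of_dissipative hcpt hK.isBounded hγ.le hγ1 hdis R
  obtain ⟨Λ, hΛ⟩ := hlip _ (Metric.isBounded_closedBall (x := (0 : H)) (r := R').prod hK.isBounded)
  have hFm : Measurable F := hF.continuous.measurable
  have hK_ae : ∀ᵐ ζ ∂ℓ, ζ ∈ ℓ.support := Measure.support_mem_ae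
  have hmaps_ae : ∀ u ∈ Metric.closedBall 0 R', ∀ᵐ ζ ∂ℓ, F (u, ζ) ∈ X := fun u hu =>
    hK_ae.mono fun ζ hζ => hmaps ⟨hu, hζ⟩
  obtain ⟨δ, hδ, hδ2, hloc⟩ := exists_locallyContracting hF hX
    (hmaps.mono_left (prod_mono_left hXB)) hK hℓ hcomp hdense
  obtain ⟨κ, C, hκ, hκ1, hC, hcontr⟩ := hloc.exists_exponentiallyContracting hδ hδ2 hFm
    (fun u hu => hmaps_ae u (hXB hu)) hγ hγ1 Λ.2
    (fun u hu => hK_ae.mono fun ζ hζ =>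
      norm_le_mul_add_mul_of_lipschitzOnWith hΛ h0 hdis0 (hXB hu) hζ) hX.isBounded h0
  have hball : Metric.closedBall (0 : H) R ⊆ Metric.closedBall 0 R' :=
    Metric.closedBall_subset_closedBall hR'
  refine ⟨κ, max 1 (C * Λ / κ), hκ, hκ1, by positivity, hcontr.of_mapsTo hκ hC.le hFm
    (fun u hu => hmaps_ae u (hball hu)) fun u hu u' hu' => hK_ae.mono fun ζ hζ => ?_⟩
  simpa using hΛ.norm_sub_le (mk_mem_prod (hball hu) hζ) (mk_mem_prod (hball hu') hζ)

end Mixing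

section Trajectories

variable {H E V Ω : Type*} [NormedAddCommGroup H] [InnerProductSpace ℝ H] [MeasurableSpace H]
  [MeasurableSpace E] [NormedAddCommGroup V] [NormedSpace ℝ V] {ι : V →L[ℝ] H} {S : H × E → V}
  {η : ℕ → Ω → E}

lemma measurable_traj_iSup_comap (hS : Measurable fun p => ι (S p)) (u : H) (k : ℕ) :
    Measurable[⨆ i ∈ Iio k, MeasurableSpace.comap (η i) inferInstance] (traj ι S η u k) := by
  induction k with
  | zero => exact measurable_const
  | succ k ih =>
    refine hS.comp (.prodMk (ih.mono ?_ le_rfl) ((comap_measurable (η k)).mono ?_ le_rfl))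
    · exact biSup_mono fun i hi => (mem_Iio.1 hi).trans (Nat.lt_succ_self k)
    · exact le_iSup₂ (f := fun i (_ : i ∈ Iio (k + 1)) => MeasurableSpace.comap (η i) inferInstance)
        k (mem_Iio.2 (Nat.lt_succ_self k))

variable [MeasurableSpace Ω] {P : Measure Ω}

lemma measurable_traj (hS : Measurable fun p => ι (S p)) (hη : ∀ k, Measurable (η k)) (u : H)
    (k : ℕ) : Measurable (traj ι S η u k) :=
  (measurable_traj_iSup_comap hS u k).mono (iSup₂_le fun i _ => (hη i).comap_le) le_rfl

lemma indepFun_traj (hS : Measurable fun p => ι (S p)) (hη : ∀ k, Measurable (η k))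
    (hind : iIndepFun η P) (u : H) (k : ℕ) : IndepFun (traj ι S η u k) (η k) P := by
  have hpast := indep_iSup_of_disjoint (m := fun i => MeasurableSpace.comap (η i) inferInstance)
    (fun i => (hη i).comap_le) hind (S := Iio k) (T := {k}) (by simp)
  rw [iSup_singleton] at hpast
  rw [IndepFun_iff_Indep]
  exact indep_of_indep_of_le_left hpast (measurable_traj_iSup_comap hS u k).comap_le

variable [IsProbabilityMeasure P]

lemma map_traj_prodMk (hS : Measurable fun p => ι (S p)) (hη : ∀ k, Measurable (η k))
    (hind : iIndepFun η P) (u : H) (k : ℕ) :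
    P.map (fun ω => (traj ι S η u k ω, η k ω)) = (transProb P ι S η k u).prod (P.map (η k)) :=
  (indepFun_iff_map_prod_eq_prod_map_map (measurable_traj hS hη u k).aemeasurable
    (hη k).aemeasurable).1 (indepFun_traj hS hη hind u k)

lemma integral_transProb_succ (hS : Measurable fun p => ι (S p)) (hη : ∀ k, Measurable (η k))
    (hind : iIndepFun η P) (u : H) (k : ℕ) {f : H → ℝ} (hf : Measurable f)
    (hf1 : ∀ x, |f x| ≤ 1) :
    ∫ x, f x ∂transProb P ι S η (k + 1) u =
      ∫ x, markovOp (P.map (η k)) (fun p => ι (S p)) f x ∂transProb P ι S η k u := by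
  have htraj := measurable_traj hS hη u
  have : IsProbabilityMeasure (P.map (η k)) := Measure.isProbabilityMeasure_map (hη k).aemeasurable
  have : IsProbabilityMeasure (transProb P ι S η k u) :=
    Measure.isProbabilityMeasure_map (htraj k).aemeasurable
  have hint : Integrable (fun p => f (ι (S p))) ((transProb P ι S η k u).prod (P.map (η k))) :=
    .of_bound (hf.comp hS).aestronglyMeasurable 1 (ae_of_all _ fun p => hf1 _)
  calc ∫ x, f x ∂transProb P ι S η (k + 1) u
      = ∫ ω, f (ι (S (traj ι S η u k ω, η k ω))) ∂P :=
        integral_map (htraj (k + 1)).aemeasurable hf.aestronglyMeasurable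
    _ = ∫ p, f (ι (S p)) ∂P.map fun ω => (traj ι S η u k ω, η k ω) :=
        (integral_map ((htraj k).prodMk (hη k)).aemeasurable
          (hf.comp hS).aestronglyMeasurable).symm
    _ = ∫ x, markovOp (P.map (η k)) (fun p => ι (S p)) f x ∂transProb P ι S η k u := by
        rw [map_traj_prodMk hS hη hind, integral_prod _ hint]
        rfl

lemma integral_transProb (hS : Measurable fun p => ι (S p)) (hη : ∀ k, Measurable (η k))
    (hind : iIndepFun η P) {ℓ : Measure E} [IsProbabilityMeasure ℓ] (hlaw : ∀ k, P.map (η k) = ℓ)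
    (u : H) (k : ℕ) {f : H → ℝ} (hf : Measurable f) (hf1 : ∀ x, |f x| ≤ 1) :
    ∫ x, f x ∂transProb P ι S η k u = (markovOp ℓ fun p => ι (S p))^[k] f u := by
  induction k generalizing f with
  | zero => simp [transProb, traj, integral_dirac' _ _ hf.stronglyMeasurable]
  | succ k ih =>
    rw [integral_transProb_succ hS hη hind u k hf hf1, hlaw, Function.iterate_succ_apply,
      ih (measurable_markovOp hS hf) (abs_markovOp_le_one hf1)]

end Trajectories

section CompactComposition

variable {H E V : Type*} [NormedAddCommGroup H] [NormedSpace ℝ H] [NormedAddCommGroup E]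
  [NormedSpace ℝ E] [NormedAddCommGroup V] [NormedSpace ℝ V] {ι : V →L[ℝ] H} {S : H × E → V}

lemma isCompact_closure_image_comp_of_lipschitzOnWith {Z : Type*} [PseudoMetricSpace Z]
    (hι : IsCompactOperator ι) {g : Z → V} {B : Set Z} {Λ : ℝ≥0} (hg : LipschitzOnWith Λ g B)
    (hB : Bornology.IsBounded B) : IsCompact (closure ((fun z => ι (g z)) '' B)) := by
  have hgB : Bornology.IsBounded (g '' B) := by
    obtain ⟨D, hD⟩ := Metric.isBounded_iff.1 hB
    refine Metric.isBounded_iff.2 ⟨Λ * D, ?_⟩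
    rintro _ ⟨p, hp, rfl⟩ _ ⟨q, hq, rfl⟩
    exact (hg.dist_le_mul p hp q hq).trans (mul_le_mul_of_nonneg_left (hD hp hq) Λ.2)
  have hιgB := hι.isCompact_closure_image_of_bounded (f := (ι : V →ₗ[ℝ] H)) hgB
  rwa [image_image] at hιgB

lemma fderiv_continuousLinearMap_comp (hS : Differentiable ℝ S) (ι : V →L[ℝ] H) (p : H × E) :
    fderiv ℝ (fun p => ι (S p)) p = ι.comp (fderiv ℝ S p) :=
  (ι.hasFDerivAt.comp p (hS p).hasFDerivAt).fderiv

lemma isCompactOperator_fderiv_comp_left (hS : Differentiable ℝ S) (hι : IsCompactOperator ι)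
    (p : H × E) : IsCompactOperator fun v : H => fderiv ℝ (fun p => ι (S p)) p (v, 0) := by
  rw [fderiv_continuousLinearMap_comp hS]
  exact hι.comp_clm ((fderiv ℝ S p).comp (ContinuousLinearMap.inl ℝ H E))

end CompactComposition

section System

variable {H E V : Type*} [NormedAddCommGroup H] [InnerProductSpace ℝ H] [NormedAddCommGroup E]
  [InnerProductSpace ℝ E] [NormedAddCommGroup V] [NormedSpace ℝ V] {ι : V →L[ℝ] H} {S : H × E → V}

lemma Regularity.exists_lipschitzOnWith (hS : Regularity S) {B : Set (H × E)}
    (hB : Bornology.IsBounded B) : ∃ Λ, LipschitzOnWith Λ S B := by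
  obtain ⟨r, hr⟩ := hB.subset_closedBall 0
  obtain ⟨C, hC⟩ := hS.2 _ (Metric.isBounded_closedBall (x := (0 : H × E)) (r := r))
  refine ⟨C.toNNReal, LipschitzOnWith.mono ?_ hr⟩
  refine (convex_closedBall 0 r).lipschitzOnWith_of_nnnorm_fderiv_le
    (fun p _ => hS.1.differentiable two_ne_zero p) fun p hp => ?_
  rw [← norm_toNNReal, ← norm_iteratedFDeriv_one]
  exact Real.toNNReal_le_toNNReal (hC p hp 1 one_le_two)

lemma Nondegenerate.denseRange_fderiv_comp_right {K : Set E} (h : Nondegenerate ι S K)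
    (hS : Differentiable ℝ S) (u : H) {ζ : E} (hζ : ζ ∈ K) :
    DenseRange fun v : E => fderiv ℝ (fun p => ι (S p)) (u, ζ) (0, v) := by
  have hpartial : fderiv ℝ (fun ζ' => S (u, ζ')) ζ =
      (fderiv ℝ S (u, ζ)).comp (ContinuousLinearMap.inr ℝ H E) :=
    ((hS (u, ζ)).hasFDerivAt.comp ζ (hasFDerivAt_prodMk_right u ζ)).fderiv
  have hrange := h u ζ hζ
  rw [hpartial] at hrange
  rwa [fderiv_continuousLinearMap_comp hS]

end System

end RDS

theorem mainTheorem2_general {H E V Ω : Type*}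
    [NormedAddCommGroup H] [InnerProductSpace ℝ H] [MeasurableSpace H] [BorelSpace H]
    [NormedAddCommGroup E] [InnerProductSpace ℝ E] [SecondCountableTopology E]
    [MeasurableSpace E] [BorelSpace E] [NormedAddCommGroup V] [NormedSpace ℝ V]
    [MeasurableSpace Ω] {P : Measure Ω} [IsProbabilityMeasure P]
    {ι : V →L[ℝ] H} (hι : IsCompactOperator ι) {S : H × E → V} (hS : ContDiff ℝ 1 S)
    (hlip : ∀ B, Bornology.IsBounded B → ∃ Λ, LipschitzOnWith Λ S B)
    {η : ℕ → Ω → E} (hη : ∀ k, Measurable (η k)) (hind : iIndepFun η P)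
    {ℓ : Measure E} (hlaw : ∀ k, P.map (η k) = ℓ) (hK : IsCompact ℓ.support)
    (hℓ : Dense (RDS.translationLipschitzSubspace ℓ : Set E)) (h0 : 0 ∈ ℓ.support)
    (hdis : RDS.Dissipative ι S ℓ.support) (hnd : RDS.Nondegenerate ι S ℓ.support) (R : ℝ) :
    ∃ κ C : ℝ, 0 < κ ∧ κ < 1 ∧ 0 < C ∧
      ∀ u ∈ Metric.closedBall (0 : H) R, ∀ u' ∈ Metric.closedBall (0 : H) R, ∀ k : ℕ,
        RDS.lipDual (RDS.transProb P ι S η k u) (RDS.transProb P ι S η k u') ≤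
          C * ‖u - u'‖ * κ ^ k := by
  have : IsProbabilityMeasure ℓ :=
    hlaw 0 ▸ Measure.isProbabilityMeasure_map (hη 0).aemeasurable
  obtain ⟨γ, β, hγ, hγ1, -, hdis⟩ := hdis
  have hSd : Differentiable ℝ S := hS.differentiable one_ne_zero
  have hF : ContDiff ℝ 1 fun p => ι (S p) := ι.contDiff.comp hS
  have hFm : Measurable fun p => ι (S p) := hF.continuous.measurable
  obtain ⟨κ, C, hκ, hκ1, hC, hcontr⟩ := RDS.exists_exponentiallyContracting_closedBall hF
    (fun B hB => (hlip B hB).imp' _ fun Λ hΛ => ι.lipschitz.comp_lipschitzOnWith hΛ)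
    (fun B hB => (hlip B hB).elim fun Λ hΛ =>
      RDS.isCompact_closure_image_comp_of_lipschitzOnWith hι hΛ hB)
    (RDS.isCompactOperator_fderiv_comp_left hSd hι) hK hℓ h0
    (fun u ζ hζ => hnd.denseRange_fderiv_comp_right hSd u hζ) hγ hγ1 (fun u => (hdis u).1)
    (fun u => (hdis u).2) R
  refine ⟨κ, C, hκ, hκ1, hC, fun u hu u' hu' k => csSup_le (RDS.lipDualSet_nonempty _ _) ?_⟩
  rintro _ ⟨f, hf1, hf, rfl⟩
  have hfm := hf.continuous.measurable
  rw [RDS.integral_transProb hFm hη hind hlaw u k hfm hf1,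
    RDS.integral_transProb hFm hη hind hlaw u' k hfm hf1]
  exact hcontr f hf1 hf u hu u' hu' k

theorem mainTheorem2
    {H E V Ω : Type*}
    [NormedAddCommGroup H] [InnerProductSpace ℝ H] [CompleteSpace H]
    [TopologicalSpace.SeparableSpace H] [MeasurableSpace H] [BorelSpace H]
    [NormedAddCommGroup E] [InnerProductSpace ℝ E] [CompleteSpace E]
    [TopologicalSpace.SeparableSpace E] [MeasurableSpace E] [BorelSpace E]
    [NormedAddCommGroup V] [NormedSpace ℝ V] [CompleteSpace V]
    [MeasurableSpace Ω] (P : Measure Ω) [IsProbabilityMeasure P]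
    (ι : V →L[ℝ] H) (hι_inj : Function.Injective ι) (hι_dense : DenseRange ι)
    (hι_compact : IsCompactOperator ι)
    (S : H × E → V)
    (η : ℕ → Ω → E) (hη_meas : ∀ k, Measurable (η k)) (hη_indep : iIndepFun η P)
    (ℓ : Measure E) (hη_law : ∀ k, P.map (η k) = ℓ)
    (hK : IsCompact ℓ.support)
    (hA1 : RDS.Regularity S)
    (hH1 : RDS.DecomposableNoise P η)
    (hH2 : RDS.Dissipative ι S ℓ.support)
    (hH3 : RDS.Nondegenerate ι S ℓ.support) :
    ∀ R : ℝ, 0 < R → ∃ κ C : ℝ, 0 < κ ∧ κ < 1 ∧ 0 < C ∧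
      ∀ u ∈ Metric.closedBall (0 : H) R, ∀ u' ∈ Metric.closedBall (0 : H) R, ∀ k : ℕ,
        RDS.lipDual (RDS.transProb P ι S η k u) (RDS.transProb P ι S η k u') ≤
          C * ‖u - u'‖ * κ ^ k := by
  intro R _
  have : SecondCountableTopology E := UniformSpace.secondCountable_of_separable E
  have hη : AEMeasurable (η 0) P := (hη_meas 0).aemeasurable
  exact mainTheorem2_general hι_compact (hA1.1.of_le one_le_two)
    (fun _ => hA1.exists_lipschitzOnWith) hη_meas hη_indep hη_law hK
    (hη_law 0 ▸ hH1.dense_translationLipschitzSubspace hη) (hη_law 0 ▸ hH1.zero_mem_support hη)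
    hH2 hH3 R
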